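/- Let $k\ge 1$ be an integer and $s\ge -\tfrac12$ a real number. Let $\mathbb R^{+k}$ be the set of vectors in $\mathbb R^k$ with nonnegative coordinates, with the Euclidean norm $\|\cdot\|$. Put $$\Lambda_s(x)=\Gamma(s+1)\,J_s(x)/(x/2)^s\quad(x>0),\qquad \Lambda_s(0)=1,$$ where $J_s$ is the Bessel function of the first kind. For $s>-\tfrac12$ let $F_s$ be the probability law on $[-1,1]$ with density $\frac{\Gamma(s+1)}{\sqrt\pi\,\Gamma(s+1/2)}(1-u^2)^{s-1/2}$, and let $F_{-1/2}=\tfrac12(\delta_{-1}+\delta_1)$. For probability measures $G_1,G_2$ on $\mathbb R^{+k}$ let $G_1\bigcirc_{s,k}G_2$ be the law of the vector with coordinates $(X_j^2+2U_jX_jY_j+Y_j^2)^{1/2}$, $1\le j\le k$, where $X,Y,U_1,\dots,U_k$ are independent, $X$ has law $G_1$, $Y$ has law $G_2$, and each $U_j$ has law $F_s$. (This is the $k$-fold Cartesian product of Kingman convolutions.) A probability measure $\mu$ on $\mathbb R^{+k}$ is $\bigcirc_{s,k}$-infinitely divisible if for every $m\ge1$ it is the $m$-fold $\bigcirc_{s,k}$-power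 of some probability measure on $\mathbb R^{+k}$. The radial characteristic function of $\mu$ is $$\hat\mu(t)=\int_{\mathbb R^{+k}}\prod_{j=1}^k\Lambda_s(t_jx_j)\,\mu(dx),\qquad t\in\mathbb R^{+k}.$$ A Lévy measure is a $\sigma$-finite measure $M$ on $\mathbb R^{+k}$ with $M(\{0\})=0$, finite outside every neighbourhood of $0$, and with $\int\frac{\|x\|^2}{1+\|x\|^2}\,M(dx)<\infty$. We say that a probability measure $\mu$ on $\mathbb R^{+k}$ has the pair $[M,\lambda]$, where $M$ is a Lévy measure and $\lambda\in\mathbb R^{+k}$, if for every $t\in\mathbb R^{+k}$ we have $\hat\mu(t)>0$ and $$-\log\hat\mu(t)=\frac12\sum_{j=1}^k\lambda_j^2t_j^2+\int_{\mathbb R^{+k}\setminus\{0\}}\Big(1-\prod_{j=1}^k\Lambda_s(t_jx_j)\Big)\frac{1+\|x\|^2}{\|x\|^2}\,M(dx),$$ with a convergent integral. Let $\sigma_s$ be the law on $[0,\infty)$ with density $\frac{2(s+1)^{s+1}}{\Gamma(s+1)}y^{2s+1}e^{-(s+1)y^2}$. A law on $\mathbb R^{+k}$ is Rayleighian if it is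 the product of the laws of $c_1Z,\dots,c_kZ$, where $Z$ has law $\sigma_s$, for some $c_1,\dots,c_k\ge0$. Then: 1. every $\bigcirc_{s,k}$-infinitely divisible probability measure on $\mathbb R^{+k}$ has exactly one pair $[M,\lambda]$; 2. two probability measures on $\mathbb R^{+k}$ that have the same pair are equal; 3. a probability measure on $\mathbb R^{+k}$ is Rayleighian if and only if it is $\bigcirc_{s,k}$-infinitely divisible and has a pair $[0,\lambda]$, that is, a pair with $M=0$, for some $\lambda\in\mathbb R^{+k}$. -/

import Mathlib

open MeasureTheory Set Topology
open scoped NNReal ENNReal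

noncomputable section

namespace Kingman

/-- The Bessel function of the first kind `J_s`, for real order `s` and `x > 0`. -/
def besselJ (s x : ℝ) : ℝ :=
  ∑' n : ℕ, (-1 : ℝ) ^ n * (x / 2) ^ (s + 2 * (n : ℝ)) /
    ((n.factorial : ℝ) * Real.Gamma (s + (n : ℝ) + 1))

/-- The kernel `Λ_s(x) = Γ(s+1) J_s(x) / (x/2)^s`, with its continuous value `1` at `x = 0`,
written as its everywhere convergent power series (see `bigLam_eq_besselJ`). -/
def bigLam (s x : ℝ) : ℝ :=
  ∑' n : ℕ, (-1 : ℝ) ^ n * Real.Gamma (s + 1) /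
    ((n.factorial : ℝ) * Real.Gamma (s + (n : ℝ) + 1)) * (x / 2) ^ (2 * n)

theorem bigLam_eq_besselJ (s : ℝ) {x : ℝ} (hx : 0 < x) :
    bigLam s x = Real.Gamma (s + 1) * besselJ s x / (x / 2) ^ s := by
  have hx2 : 0 < x / 2 := by positivity
  have hne : (x / 2) ^ s ≠ 0 := (Real.rpow_pos_of_pos hx2 s).ne'
  rw [mul_div_right_comm, besselJ, bigLam, ← tsum_mul_left]
  refine tsum_congr fun n => ?_
  rw [Real.rpow_add hx2, show (2 * (n : ℝ)) = ((2 * n : ℕ) : ℝ) by push_cast; ring,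
    Real.rpow_natCast, div_mul_div_comm, div_mul_eq_mul_div, mul_comm ((x / 2) ^ s),
    show Real.Gamma (s + 1) *
        ((-1) ^ n * ((x / 2) ^ (2 * n) * (x / 2) ^ s)) =
      (x / 2) ^ s * ((-1) ^ n * Real.Gamma (s + 1) * (x / 2) ^ (2 * n)) by ring,
    mul_div_mul_left _ _ hne]

theorem bigLam_zero {s : ℝ} (hs : -1 / 2 ≤ s) : bigLam s 0 = 1 := by
  have hG : Real.Gamma (s + 1) ≠ 0 := (Real.Gamma_pos_of_pos (by linarith)).ne'
  rw [bigLam, tsum_eq_single 0]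
  · simp [hG]
  · intro n hn
    simp [hn]

/-- The law on `[-1,1]` of the cosine `u` in the definition of the Kingman convolution: it has
density `Γ(s+1) / (√π Γ(s+1/2)) * (1-u^2)^(s-1/2)` for `s > -1/2`; for `s = -1/2` it is the
weak limit of these laws as `s` decreases to `-1/2`, the symmetric law on `{-1, 1}`. -/
def angularLaw (s : ℝ) : Measure ℝ :=
  if s = -1 / 2 then
    (2⁻¹ : ℝ≥0∞) • (Measure.dirac (-1) + Measure.dirac 1)
  else
    (volume.restrict (Ioo (-1 : ℝ) 1)).withDensity fun u =>
      ENNReal.ofReal (Real.Gamma (s + 1) / (√Real.pi * Real.Gamma (s + 1 / 2)) *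
        (1 - u ^ 2) ^ (s - 1 / 2))

/-- `(x^2 + 2uxy + y^2)^(1/2)`. -/
def triangle (u : ℝ) (x y : ℝ≥0) : ℝ≥0 :=
  (√((x : ℝ) ^ 2 + 2 * u * x * y + (y : ℝ) ^ 2)).toNNReal

/-- The `k`-fold Cartesian product of Kingman convolutions: for `x`, `y` and `u_1, …, u_k`
independent, `x` and `y` with laws `G₁` and `G₂` and the `u_j` with law `angularLaw s`, the law of
the vector with coordinates `(x_j^2 + 2 u_j x_j y_j + y_j^2)^(1/2)`. For point masses at `x` and `y`
this is the product over `j` of the one-dimensional Kingman convolutions of point masses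
at `x_j` and `y_j`, and in general the mixture of these with respect to `G₁ × G₂`. -/
def conv {k : ℕ} (s : ℝ) (G₁ G₂ : Measure (Fin k → ℝ≥0)) : Measure (Fin k → ℝ≥0) :=
  ((G₁.prod G₂).prod (Measure.pi fun _ : Fin k => angularLaw s)).map
    fun p j => triangle (p.2 j) (p.1.1 j) (p.1.2 j)

/-- The `m`-fold power for `conv s`; the point mass at `0` is the unit. -/
def convPow {k : ℕ} (s : ℝ) (G : Measure (Fin k → ℝ≥0)) : ℕ → Measure (Fin k → ℝ≥0)
  | 0 => Measure.dirac 0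
  | m + 1 => conv s (convPow s G m) G

/-- Infinite divisibility with respect to `conv s`. -/
def IsInfDiv {k : ℕ} (s : ℝ) (μ : Measure (Fin k → ℝ≥0)) : Prop :=
  ∀ m : ℕ, 1 ≤ m →
    ∃ ν : Measure (Fin k → ℝ≥0), IsProbabilityMeasure ν ∧ μ = convPow s ν m

/-- The radial characteristic function. -/
def radCF {k : ℕ} (s : ℝ) (μ : Measure (Fin k → ℝ≥0)) (t : Fin k → ℝ≥0) : ℝ :=
  ∫ x, ∏ j, bigLam s ((t j : ℝ) * x j) ∂μ

/-- The squared Euclidean norm. -/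
def normSq {k : ℕ} (x : Fin k → ℝ≥0) : ℝ := ∑ j, (x j : ℝ) ^ 2

/-- Lévy measures on the cone of vectors with nonnegative coordinates. -/
structure IsLevyMeasure {k : ℕ} (M : Measure (Fin k → ℝ≥0)) : Prop where
  sigmaFinite : SigmaFinite M
  zero : M {0} = 0
  finite_compl : ∀ U ∈ 𝓝 (0 : Fin k → ℝ≥0), M Uᶜ < ∞
  lintegral_lt_top : ∫⁻ x, ENNReal.ofReal (normSq x / (1 + normSq x)) ∂M < ∞

/-- The integrand `(1 - ∏ Λ_s(t_j x_j)) (1 + ‖x‖^2) / ‖x‖^2` of the Lévy–Khinchin formula.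
Its value at `x = 0` is irrelevant, as Lévy measures do not charge `0`; the Gaussian part is a
separate term in `HasLevyPair`. -/
def levyIntegrand {k : ℕ} (s : ℝ) (t x : Fin k → ℝ≥0) : ℝ :=
  (1 - ∏ j, bigLam s ((t j : ℝ) * x j)) * ((1 + normSq x) / normSq x)

/-- `[M, lam]` represents `μ`: `M` is a Lévy measure, and for all `t` the Lévy–Khinchin integral
converges and
`-log (radCF s μ t) = (1/2) ∑ lam_j^2 t_j^2 + ∫ (1 - ∏ Λ_s(t_j x_j)) (1 + ‖x‖^2) / ‖x‖^2 M(dx)`. -/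
structure HasLevyPair {k : ℕ} (s : ℝ) (μ M : Measure (Fin k → ℝ≥0)) (lam : Fin k → ℝ≥0) :
    Prop where
  isLevyMeasure : IsLevyMeasure M
  integrable : ∀ t : Fin k → ℝ≥0, Integrable (levyIntegrand s t) M
  radCF_pos : ∀ t : Fin k → ℝ≥0, 0 < radCF s μ t
  neg_log_radCF : ∀ t : Fin k → ℝ≥0,
    -Real.log (radCF s μ t) =
      (1 / 2 : ℝ) * ∑ j, (lam j : ℝ) ^ 2 * (t j : ℝ) ^ 2 + ∫ x, levyIntegrand s t x ∂M

/-- The characteristic measure `σ_s` of the Kingman convolution, with density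
`2 (s+1)^(s+1) / Γ(s+1) * y^(2s+1) * exp (-(s+1) y^2)` on the positive half-line. -/
def rayleigh (s : ℝ) : Measure ℝ≥0 :=
  ((volume.restrict (Ioi (0 : ℝ))).withDensity fun y =>
    ENNReal.ofReal (2 * (s + 1) ^ (s + 1) / Real.Gamma (s + 1) * y ^ (2 * s + 1) *
      Real.exp (-(s + 1) * y ^ 2))).map Real.toNNReal

/-- Rayleighian laws: products of rescaled copies `T_{lam_j} σ_s`, with `lam_j ≥ 0`. -/
def IsRayleighian {k : ℕ} (s : ℝ) (μ : Measure (Fin k → ℝ≥0)) : Prop :=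
  ∃ lam : Fin k → ℝ≥0, μ = Measure.pi fun j => (rayleigh s).map fun y => lam j * y

end Kingman

end

namespace Kingman

open Filter

/-! Write `κ = curv s = 1/(4(s+1))`. The kernel `Λ_s` behaves like a cosine: it is the
characteristic function of `F_s` (`integral_cos_angularLaw`), and Sonine's product formula
(`integral_bigLam_triangle`), coefficient by coefficient the Chu–Vandermonde identity, makes the
radial characteristic function multiplicative (`radCF_conv`). The law `σ_s` is the matching
Gaussian, with transform `exp(-κx²)`. Since the kernel is symmetric in `t` and `x`, integrating
`radCF s μ` against products of Rayleigh laws gives `∫ exp(-∑ n_j x_j²) dμ`; Stone–Weierstrass then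
yields injectivity (`ext_of_radCF`), hence assertion 2 and, with the explicit Rayleigh transform,
assertion 3.

Uniqueness of the pair: averaging `-log radCF` over the same Rayleigh laws gives the Bernstein
function `∑ n_j λ_j²/(2κ) + ∫ (1 - exp(-∑ n_j x_j²)) (1+‖x‖²)/‖x‖² dM`. Its difference in direction
`j` is the Laplace transform of a finite measure with atom `λ_j²/(2κ)` at `0` and density `(1 -
exp(-x_j²)) (1+‖x‖²)/‖x‖²` with respect to `M`; these measures give back `λ` and `M`.

Existence: for odd `N` let `ν_N` be an `N`-th root of `μ`. Then `N(1 - radCF ν_N)` tends to `-log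
radCF μ`. Telescoping the product gives `1 - ∏ Λ_s(t_j x_j) = ∑ w_j T_j` with `w_j = x_j²/(1+x_j²)`,
where `T_j` is bounded and continuous and `T_j(0) = κ t_j²`. So the exponent is the limit of `∑ ∫
T_j dV_{N,j}` with `V_{N,j} = N w_j ν_N`. Continuity of `radCF μ` at `0`, propagated by `1 - cos nθ
≤ n²(1 - cos θ)` and averaged over a Rayleigh law, makes these measures tight. The limits satisfy
`w_i V_j = w_j V_i`, so off `0` they glue to one Lévy measure, and their atoms at `0` give `λ`. One
weight per coordinate is needed: for `k > 1` the quotient of `1 - ∏ Λ_s(t_j x_j)` by `‖x‖²` depends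
on the direction as `x → 0`. -/

/-! ### Rising factorials and the Chu–Vandermonde identity -/

/-- The rising factorial `c (c+1) ⋯ (c+n-1)`. -/
noncomputable def rising (c : ℝ) (n : ℕ) : ℝ := ∏ i ∈ Finset.range n, (c + i)

@[simp] theorem rising_zero (c : ℝ) : rising c 0 = 1 := by simp [rising]

theorem rising_succ (c : ℝ) (n : ℕ) : rising c (n + 1) = rising c n * (c + n) := by
  simp [rising, Finset.prod_range_succ]

theorem rising_succ' (c : ℝ) (n : ℕ) : rising c (n + 1) = c * rising (c + 1) n := by
  rw [rising, Finset.prod_range_succ', mul_comm, rising]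
  congr 1
  · simp
  · refine Finset.prod_congr rfl fun i _ => ?_
    push_cast
    ring

theorem rising_pos {c : ℝ} (hc : 0 < c) (n : ℕ) : 0 < rising c n :=
  Finset.prod_pos fun i _ => by positivity

theorem rising_add (c : ℝ) (m n : ℕ) : rising c (m + n) = rising c m * rising (c + m) n := by
  induction n with
  | zero => simp
  | succ n ih => rw [← add_assoc, rising_succ, ih, rising_succ]; push_cast; ring

/-- Only the first factor can be below `1`, and it is at least `1/2`; the others are at least `3/2`.
With `c = s + 1` this bounds the coefficients of `Λ_s` by `2/n!` uniformly in `s ≥ -1/2`. -/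
theorem half_le_rising {c : ℝ} (hc : 1 / 2 ≤ c) (n : ℕ) : 1 / 2 ≤ rising c n := by
  rcases n with _ | n
  · norm_num
  induction n with
  | zero => simpa [rising] using hc
  | succ n ih =>
    rw [rising_succ]
    push_cast
    nlinarith [(Nat.cast_nonneg n : (0 : ℝ) ≤ n)]

theorem Gamma_add_natCast {c : ℝ} (hc : 0 < c) (n : ℕ) :
    Real.Gamma (c + n) = Real.Gamma c * rising c n := by
  induction n with
  | zero => simp
  | succ n ih =>
    rw [Nat.cast_succ, ← add_assoc, Real.Gamma_add_one (by positivity), ih, rising_succ]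
    ring

theorem rising_half (n : ℕ) :
    rising (1 / 2) n = ((2 * n).factorial : ℝ) / (4 ^ n * n.factorial) := by
  induction n with
  | zero => simp
  | succ n ih =>
    rw [rising_succ, ih, show 2 * (n + 1) = 2 * n + 1 + 1 by ring, Nat.factorial_succ,
      Nat.factorial_succ, Nat.factorial_succ]
    push_cast
    field_simp
    ring

/-- The Chu–Vandermonde identity. -/
theorem sum_choose_mul_descFactorial_div_rising (i : ℕ) :
    ∀ (j : ℕ) {c : ℝ}, 0 < c →
      ∑ l ∈ Finset.range (i + 1), (i.choose l : ℝ) * (j.descFactorial l) / rising c l =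
        rising (c + j) i / rising c i := by
  induction i with
  | zero => intro j c hc; simp
  | succ i ih =>
    intro j c hc
    -- Pascal's rule splits the sum. In the second half a factor `j/c` comes out, leaving the same
    -- sum with `j` and `c` replaced by `j - 1` and `c + 1`; hence the induction quantifies over
    -- both.
    have h1 : ∑ l ∈ Finset.range (i + 1 + 1), ((i + 1).choose l : ℝ) * (j.descFactorial l) /
        rising c l = ∑ l ∈ Finset.range (i + 1), (i.choose l : ℝ) * (j.descFactorial l) / rising c l
          + ∑ l ∈ Finset.range (i + 1), (i.choose l : ℝ) * (j.descFactorial (l + 1)) /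
            rising c (l + 1) := by
      rw [Finset.sum_range_succ', ← add_zero (∑ l ∈ Finset.range (i + 1), (i.choose l : ℝ) *
        (j.descFactorial l) / rising c l)]
      have h2 : ∑ l ∈ Finset.range (i + 1), (i.choose l : ℝ) * (j.descFactorial l) / rising c l + 0 =
        ∑ l ∈ Finset.range (i + 1 + 1), (i.choose l : ℝ) * (j.descFactorial l) / rising c l := by
        rw [Finset.sum_range_succ _ (i + 1)]
        simp
      rw [h2, Finset.sum_range_succ' _ (i + 1), add_right_comm, ← Finset.sum_add_distrib]
      congr 1
      · refine Finset.sum_congr rfl fun l _ => ?_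
        rw [Nat.choose_succ_succ]
        push_cast
        ring
      · simp
    rw [h1, ih j hc]
    rcases j with _ | j
    · have : ∑ l ∈ Finset.range (i + 1), (i.choose l : ℝ) * ((0 : ℕ).descFactorial (l + 1)) /
            rising c (l + 1) = 0 := Finset.sum_eq_zero fun l _ => by simp
      rw [this]
      simp [(rising_pos hc _).ne']
    · have h3 : ∑ l ∈ Finset.range (i + 1), (i.choose l : ℝ) * ((j + 1).descFactorial (l + 1)) /
            rising c (l + 1) = (j + 1) / c *
          ∑ l ∈ Finset.range (i + 1), (i.choose l : ℝ) * (j.descFactorial l) / rising (c + 1) l := by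
        rw [Finset.mul_sum]
        refine Finset.sum_congr rfl fun l _ => ?_
        have := (rising_pos (show 0 < c + 1 by linarith) l).ne'
        rw [Nat.succ_descFactorial_succ, rising_succ']
        push_cast
        field_simp
      rw [h3, ih j (by linarith : 0 < c + 1)]
      have e1 : c + 1 + (j : ℝ) = c + ((j + 1 : ℕ) : ℝ) := by push_cast; ring
      rw [e1, rising_succ (c + ((j + 1 : ℕ) : ℝ)) i]
      have hp := rising_pos hc i
      have hp1 := rising_pos (show 0 < c + 1 by linarith) i
      have e2 : rising c i * (c + i) = c * rising (c + 1) i := by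
        rw [← rising_succ, rising_succ']
      have e3 : rising (c + 1) i = rising c i * (c + i) / c := by rw [e2]; field_simp
      have hci : 0 < c + (i : ℝ) := by positivity
      rw [rising_succ, e3]
      push_cast
      field_simp
      ring

/-- The form of Chu–Vandermonde used in the product formula, where `l` is half the exponent of the
cosine variable `u`. -/
theorem rising_add_div {c : ℝ} (hc : 0 < c) (i j : ℕ) :
    rising c (i + j) / (rising c i * rising c j) =
      ∑ l ∈ Finset.range (i + 1), (i.choose l : ℝ) * (j.descFactorial l) / rising c l := by
  rw [sum_choose_mul_descFactorial_div_rising i j hc, add_comm i j, rising_add]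
  have := (rising_pos hc i).ne'
  have := (rising_pos hc j).ne'
  field_simp

/-! ### The power series of the kernel -/

/-- The coefficients of `Λ_s` as a power series in `-x²/4`. -/
noncomputable def lamCoeff (s : ℝ) (n : ℕ) : ℝ := 1 / (n.factorial * rising (s + 1) n)

theorem lamCoeff_pos {s : ℝ} (hs : -1 / 2 ≤ s) (n : ℕ) : 0 < lamCoeff s n := by
  have := rising_pos (show 0 < s + 1 by linarith) n
  unfold lamCoeff
  positivity

theorem lamCoeff_le {s : ℝ} (hs : -1 / 2 ≤ s) (n : ℕ) : lamCoeff s n ≤ 2 / n.factorial := by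
  have h := half_le_rising (show 1 / 2 ≤ s + 1 by linarith) n
  have hn : (0 : ℝ) < n.factorial := by positivity
  rw [lamCoeff, div_le_div_iff₀ (by positivity) hn]
  nlinarith

/-- The entire function `L` with `Λ_s(x) = L(-x²/4)`. -/
noncomputable def lamSeries (s z : ℝ) : ℝ := ∑' n : ℕ, lamCoeff s n * z ^ n

/-- Stated for general coefficients since it serves both `lamSeries` and, with shifted coefficients,
`lamQuot`. -/
theorem summable_norm_mul_pow_of_abs_le {c : ℕ → ℝ} (hc : ∀ n, |c n| ≤ 2 / n.factorial) (z : ℝ) :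
    Summable fun n : ℕ => ‖c n * z ^ n‖ := by
  refine Summable.of_nonneg_of_le (fun n => norm_nonneg _) (fun n => ?_)
    ((Real.summable_pow_div_factorial |z|).mul_left 2)
  rw [norm_mul, norm_pow, Real.norm_eq_abs, Real.norm_eq_abs]
  calc |c n| * |z| ^ n ≤ 2 / n.factorial * |z| ^ n := by gcongr; exact hc n
    _ = 2 * (|z| ^ n / n.factorial) := by ring

theorem continuous_tsum_mul_pow {c : ℕ → ℝ} (hc : ∀ n, |c n| ≤ 2 / n.factorial) :
    Continuous fun z : ℝ => ∑' n, c n * z ^ n := by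
  refine continuous_iff_continuousAt.2 fun z => ?_
  have h : ContinuousOn (fun z : ℝ => ∑' n, c n * z ^ n) (Metric.ball 0 (|z| + 1)) := by
    refine continuousOn_tsum (fun n => by fun_prop)
      (summable_norm_mul_pow_of_abs_le hc (|z| + 1)) ?_
    intro n y hy
    rw [norm_mul, norm_mul, norm_pow, norm_pow, Real.norm_of_nonneg (by positivity : 0 ≤ |z| + 1)]
    have := (mem_ball_zero_iff.1 hy).le
    gcongr
  refine h.continuousAt (Metric.isOpen_ball.mem_nhds ?_)
  simp

theorem abs_lamCoeff_le {s : ℝ} (hs : -1 / 2 ≤ s) (n : ℕ) : |lamCoeff s n| ≤ 2 / n.factorial := by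
  rw [abs_of_pos (lamCoeff_pos hs n)]
  exact lamCoeff_le hs n

theorem summable_lamSeries {s : ℝ} (hs : -1 / 2 ≤ s) (z : ℝ) :
    Summable fun n : ℕ => ‖lamCoeff s n * z ^ n‖ :=
  summable_norm_mul_pow_of_abs_le (abs_lamCoeff_le hs) z

theorem bigLam_eq_lamSeries {s : ℝ} (hs : -1 / 2 ≤ s) (x : ℝ) :
    bigLam s x = lamSeries s (-(x ^ 2 / 4)) := by
  refine tsum_congr fun n => ?_
  have h : s + (n : ℝ) + 1 = s + 1 + n := by ring
  have hG := (Real.Gamma_pos_of_pos (show 0 < s + 1 by linarith)).ne'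
  have hp := (rising_pos (show 0 < s + 1 by linarith) n).ne'
  rw [h, Gamma_add_natCast (by linarith), lamCoeff, neg_pow (x ^ 2 / 4), pow_mul,
    show (x / 2) ^ 2 = x ^ 2 / 4 by ring]
  field_simp

/-- Termwise integration of the series `L` along a bounded function. -/
theorem integral_lamSeries {α : Type*} [MeasurableSpace α] {s : ℝ} (hs : -1 / 2 ≤ s)
    {μ : Measure α} [IsFiniteMeasure μ] {z : α → ℝ} (hz : Measurable z) {R : ℝ}
    (hR : ∀ᵐ a ∂μ, |z a| ≤ R) :
    HasSum (fun n => lamCoeff s n * ∫ a, z a ^ n ∂μ) (∫ a, lamSeries s (z a) ∂μ) := by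
  have h := hasSum_integral_of_dominated_convergence (μ := μ)
    (F := fun n a => lamCoeff s n * z a ^ n) (f := fun a => lamSeries s (z a))
    (fun n _ => ‖lamCoeff s n * R ^ n‖)
    (fun n => ((hz.pow_const n).const_mul _).aestronglyMeasurable)
    (fun n => by
      filter_upwards [hR] with a ha
      have : 0 ≤ R := (abs_nonneg _).trans ha
      rw [norm_mul, norm_mul, norm_pow, norm_pow, Real.norm_eq_abs (z a), Real.norm_of_nonneg this]
      gcongr)
    (ae_of_all _ fun _ => summable_lamSeries hs R)
    (integrable_const _)
    (ae_of_all _ fun a => ((summable_lamSeries hs (z a)).of_norm).hasSum)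
  simpa only [integral_const_mul] using h

theorem continuous_lamSeries {s : ℝ} (hs : -1 / 2 ≤ s) : Continuous (lamSeries s) :=
  continuous_tsum_mul_pow (abs_lamCoeff_le hs)

theorem continuous_bigLam {s : ℝ} (hs : -1 / 2 ≤ s) : Continuous (bigLam s) := by
  have : bigLam s = fun x => lamSeries s (-(x ^ 2 / 4)) := funext (bigLam_eq_lamSeries hs)
  rw [this]
  exact (continuous_lamSeries hs).comp (by fun_prop)

/-! ### Moments of the angular law and Poisson's integral for the kernel -/

theorem setIntegral_Ioo_rpow_mul_one_sub_rpow {a b : ℝ} (ha : 0 < a) (hb : 0 < b) :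
    ∫ v in Ioo (0 : ℝ) 1, v ^ (a - 1) * (1 - v) ^ (b - 1) =
      Real.Gamma a * Real.Gamma b / Real.Gamma (a + b) := by
  have h := ProbabilityTheory.beta_eq_betaIntegralReal a b ha hb
  rw [ProbabilityTheory.beta, Complex.betaIntegral,
    intervalIntegral.integral_of_le zero_le_one, integral_Ioc_eq_integral_Ioo] at h
  have h2 : ∫ v in Ioo (0 : ℝ) 1, (v : ℂ) ^ ((a : ℂ) - 1) * (1 - (v : ℂ)) ^ ((b : ℂ) - 1) =
      ∫ v in Ioo (0 : ℝ) 1, ((v ^ (a - 1) * (1 - v) ^ (b - 1) : ℝ) : ℂ) := by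
    refine setIntegral_congr_fun measurableSet_Ioo fun v hv => ?_
    have h1 : (0 : ℝ) ≤ 1 - v := by linarith [hv.2]
    rw [Complex.ofReal_mul, Complex.ofReal_cpow hv.1.le, Complex.ofReal_cpow h1]
    push_cast
    rfl
  rw [h2, integral_complex_ofReal, Complex.ofReal_re] at h
  exact h.symm

/-- Half of an even moment of the unnormalized density of `angularLaw`. -/
theorem setIntegral_Ioo_pow_mul_one_sub_sq_rpow {s : ℝ} (hs : -1 / 2 < s) (n : ℕ) :
    ∫ u in Ioo (0 : ℝ) 1, u ^ (2 * n) * (1 - u ^ 2) ^ (s - 1 / 2) =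
      Real.Gamma (n + 1 / 2) * Real.Gamma (s + 1 / 2) / (2 * Real.Gamma (s + 1 + n)) := by
  -- The substitution `v = u²` turns the moment into a Beta integral with parameters `n + 1/2` and
  -- `s + 1/2`; the indicator cuts the half-line formula down to `(0,1)`.
  have h := integral_comp_rpow_Ioi_of_pos
    (g := (Ioo (0 : ℝ) 1).indicator fun v => v ^ ((n + 1 / 2 : ℝ) - 1) * (1 - v) ^ (s + 1 / 2 - 1))
    (zero_lt_two)
  rw [setIntegral_indicator measurableSet_Ioo,
    inter_eq_self_of_subset_right Ioo_subset_Ioi_self,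
    setIntegral_Ioo_rpow_mul_one_sub_rpow (by positivity) (by linarith)] at h
  have e : (n + 1 / 2 : ℝ) + (s + 1 / 2) = s + 1 + n := by ring
  rw [e] at h
  have h3 : ∫ x in Ioi (0 : ℝ), (2 * x ^ ((2 : ℝ) - 1)) •
      (Ioo (0 : ℝ) 1).indicator (fun v => v ^ ((n + 1 / 2 : ℝ) - 1) * (1 - v) ^ (s + 1 / 2 - 1))
        (x ^ (2 : ℝ)) = ∫ x in Ioi (0 : ℝ), (Ioo (0 : ℝ) 1).indicator
          (fun u => 2 * (u ^ (2 * n) * (1 - u ^ 2) ^ (s - 1 / 2))) x := by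
    refine setIntegral_congr_fun measurableSet_Ioi fun x hx => ?_
    have hx0 : (0 : ℝ) < x := hx
    simp only [smul_eq_mul]
    by_cases h1 : x < 1
    · have hm : x ^ (2 : ℝ) ∈ Ioo (0 : ℝ) 1 :=
        ⟨by positivity, Real.rpow_lt_one hx0.le h1 (by norm_num)⟩
      rw [indicator_of_mem hm, indicator_of_mem (show x ∈ Ioo (0 : ℝ) 1 from ⟨hx0, h1⟩),
        ← Real.rpow_mul hx0.le, Real.rpow_two]
      have e1 : x ^ (2 * n) = x ^ ((2 : ℝ) - 1) * x ^ (2 * ((n + 1 / 2 : ℝ) - 1)) := by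
        rw [← Real.rpow_add hx0, ← Real.rpow_natCast]
        congr 1
        push_cast
        ring
      have e2 : s + 1 / 2 - 1 = s - 1 / 2 := by ring
      rw [e1, e2]
      ring
    · have hm : x ^ (2 : ℝ) ∉ Ioo (0 : ℝ) 1 := fun hm =>
        absurd hm.2 (not_lt.2 (Real.one_le_rpow (not_lt.1 h1) (by norm_num)))
      rw [indicator_of_notMem hm, indicator_of_notMem (fun hm => h1 hm.2), mul_zero]
  rw [h3, setIntegral_indicator measurableSet_Ioo,
    inter_eq_self_of_subset_right Ioo_subset_Ioi_self, integral_const_mul] at h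
  rw [mul_comm 2 (Real.Gamma (s + 1 + n)), ← div_div, ← h]
  ring

/-- A nonintegrable function has Bochner integral `0` by convention, whereas the Gamma quotient is
positive; so integrability follows from the value of the integral. -/
theorem integrableOn_Ioo_pow_mul_one_sub_sq_rpow {s : ℝ} (hs : -1 / 2 < s) (n : ℕ) :
    IntegrableOn (fun u : ℝ => u ^ (2 * n) * (1 - u ^ 2) ^ (s - 1 / 2)) (Ioo 0 1) := by
  by_contra h
  have h1 := setIntegral_Ioo_pow_mul_one_sub_sq_rpow hs n
  rw [integral_undef h] at h1
  have := Real.Gamma_pos_of_pos (show (0 : ℝ) < n + 1 / 2 by positivity)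
  have := Real.Gamma_pos_of_pos (show (0 : ℝ) < s + 1 / 2 by linarith)
  have := Real.Gamma_pos_of_pos (show (0 : ℝ) < s + 1 + n by
    have : (0 : ℝ) ≤ n := Nat.cast_nonneg n
    linarith)
  have : 0 < Real.Gamma (n + 1 / 2) * Real.Gamma (s + 1 / 2) / (2 * Real.Gamma (s + 1 + n)) := by
    positivity
  linarith

theorem setIntegral_Ioo_neg_one_one {f : ℝ → ℝ} (hf : IntegrableOn f (Ioo 0 1))
    (heven : ∀ u, f (-u) = f u) :
    IntegrableOn f (Ioo (-1) 1) ∧ ∫ u in Ioo (-1 : ℝ) 1, f u = 2 * ∫ u in Ioo (0 : ℝ) 1, f u := by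
  have hi : IntervalIntegrable f volume 0 1 :=
    (intervalIntegrable_iff_integrableOn_Ioo_of_le zero_le_one).2 hf
  have hi' : IntervalIntegrable f volume (-1) 0 := by
    have := ((IntervalIntegrable.iff_comp_neg (by finiteness)).1 hi).symm
    simpa [heven] using this
  have hI := hi'.trans hi
  refine ⟨(intervalIntegrable_iff_integrableOn_Ioo_of_le (by norm_num)).1 hI, ?_⟩
  have h := intervalIntegral.integral_add_adjacent_intervals hi' hi
  have h2 : ∫ u in (-1 : ℝ)..0, f u = ∫ u in (0 : ℝ)..1, f u := by
    have := intervalIntegral.integral_comp_neg (a := (0 : ℝ)) (b := 1) f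
    simp only [heven, neg_zero] at this
    exact this.symm
  rw [h2, intervalIntegral.integral_of_le (by norm_num), intervalIntegral.integral_of_le (by norm_num),
    integral_Ioc_eq_integral_Ioo, integral_Ioc_eq_integral_Ioo] at h
  rw [← h]
  ring

theorem angularLaw_ae_mem {s : ℝ} : ∀ᵐ u ∂angularLaw s, u ∈ Icc (-1 : ℝ) 1 := by
  unfold angularLaw
  split_ifs with h
  · refine Measure.ae_smul_measure ?_ _
    rw [ae_add_measure_iff]
    constructor <;>
    · refine (ae_dirac_iff measurableSet_Icc).2 ?_
      norm_num
  · refine (withDensity_absolutelyContinuous _ _).ae_le ?_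
    filter_upwards [ae_restrict_mem measurableSet_Ioo] with u hu
    exact Ioo_subset_Icc_self hu

theorem integral_angularLaw_of_ne {s : ℝ} (hs : -1 / 2 < s) (f : ℝ → ℝ) :
    ∫ u, f u ∂angularLaw s = Real.Gamma (s + 1) / (√Real.pi * Real.Gamma (s + 1 / 2)) *
      ∫ u in Ioo (-1 : ℝ) 1, f u * (1 - u ^ 2) ^ (s - 1 / 2) := by
  have hG := Real.Gamma_pos_of_pos (show (0 : ℝ) < s + 1 / 2 by linarith)
  have hG1 := Real.Gamma_pos_of_pos (show (0 : ℝ) < s + 1 by linarith)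
  have hpi := Real.sqrt_pos.2 Real.pi_pos
  rw [angularLaw, if_neg hs.ne', integral_withDensity_eq_integral_toReal_smul (by fun_prop)
    (ae_of_all _ fun _ => ENNReal.ofReal_lt_top), ← integral_const_mul]
  refine setIntegral_congr_fun measurableSet_Ioo fun u hu => ?_
  have h1 : 0 ≤ 1 - u ^ 2 := by nlinarith [hu.1, hu.2]
  simp only [smul_eq_mul]
  rw [ENNReal.toReal_ofReal (by positivity)]
  ring

theorem integral_angularLaw_neg_half (f : ℝ → ℝ) :
    ∫ u, f u ∂angularLaw (-1 / 2) = (f (-1) + f 1) / 2 := by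
  rw [angularLaw, if_pos rfl, integral_smul_measure, integral_add_measure, integral_dirac,
    integral_dirac]
  · simp
    ring
  · exact integrable_dirac (by simp)
  · exact integrable_dirac (by simp)

/-- The case `s = -1/2` fits the same formula because `(1/2)_n = (2n)!/(4^n n!)`, so that all
moments are `1`. -/
theorem integral_pow_even_angularLaw {s : ℝ} (hs : -1 / 2 ≤ s) (n : ℕ) :
    ∫ u, u ^ (2 * n) ∂angularLaw s =
      ((2 * n).factorial : ℝ) / (4 ^ n * n.factorial * rising (s + 1) n) := by
  rcases hs.eq_or_lt with rfl | hs
  · rw [integral_angularLaw_neg_half]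
    have h : (-1 / 2 : ℝ) + 1 = 1 / 2 := by norm_num
    rw [h, rising_half]
    have : ((2 * n).factorial : ℝ) ≠ 0 := by positivity
    simp only [pow_mul]
    field_simp
    norm_num
  · rw [integral_angularLaw_of_ne hs, (setIntegral_Ioo_neg_one_one
      (integrableOn_Ioo_pow_mul_one_sub_sq_rpow hs n) (fun u => by simp [pow_mul])).2,
      setIntegral_Ioo_pow_mul_one_sub_sq_rpow hs, Gamma_add_natCast (by linarith), add_comm (n : ℝ),
      Gamma_add_natCast (by norm_num), rising_half, Real.Gamma_one_half_eq]
    have hG := Real.Gamma_pos_of_pos (show (0 : ℝ) < s + 1 / 2 by linarith)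
    have hG1 := Real.Gamma_pos_of_pos (show (0 : ℝ) < s + 1 by linarith)
    have hpi := Real.sqrt_pos.2 Real.pi_pos
    have := rising_pos (show (0 : ℝ) < s + 1 by linarith) n
    generalize Real.Gamma (s + 1 / 2) = G at *
    field_simp

theorem integral_odd_angularLaw (s : ℝ) (hs : -1 / 2 ≤ s) {f : ℝ → ℝ}
    (hodd : ∀ u, f (-u) = -f u) : ∫ u, f u ∂angularLaw s = 0 := by
  rcases hs.eq_or_lt with rfl | hs
  · rw [integral_angularLaw_neg_half, hodd]
    simp
  · rw [integral_angularLaw_of_ne hs, ← integral_Ioc_eq_integral_Ioo,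
      ← intervalIntegral.integral_of_le (by norm_num)]
    have h := intervalIntegral.integral_comp_neg (a := (-1 : ℝ)) (b := 1)
      (fun u => f u * (1 - u ^ 2) ^ (s - 1 / 2))
    simp only [hodd, neg_neg, neg_sq, neg_mul, intervalIntegral.integral_neg] at h
    have : ∫ u in (-1 : ℝ)..1, f u * (1 - u ^ 2) ^ (s - 1 / 2) = 0 := by linarith
    rw [this, mul_zero]

/-- The zeroth moment is the real-valued total mass; as it equals `1` and not `0`, the mass cannot
be infinite. -/
theorem isProbabilityMeasure_angularLaw {s : ℝ} (hs : -1 / 2 ≤ s) :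
    IsProbabilityMeasure (angularLaw s) := by
  have h := integral_pow_even_angularLaw hs 0
  simp only [mul_zero, pow_zero, integral_const, smul_eq_mul, mul_one, Nat.factorial_zero,
    Nat.cast_one, rising_zero, div_one] at h
  refine ⟨?_⟩
  rw [Measure.real, ENNReal.toReal_eq_one_iff] at h
  exact h

/-- Poisson's integral. Integrating the cosine series term by term, the `(2n)!` of the cosine
cancels against that of the moment. Bounds on `Λ_s` then come from averaging bounds on the cosine.
-/
theorem integral_cos_angularLaw {s : ℝ} (hs : -1 / 2 ≤ s) (x : ℝ) :
    ∫ u, Real.cos (x * u) ∂angularLaw s = bigLam s x := by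
  have := isProbabilityMeasure_angularLaw hs
  have hinj : Function.Injective fun n : ℕ => 2 * n := fun a b hab => by simpa using hab
  have hsum : Summable fun n : ℕ => |x| ^ (2 * n) / ((2 * n).factorial : ℝ) :=
    (Real.summable_pow_div_factorial |x|).comp_injective hinj
  have hbound : ∀ n : ℕ, ∀ᵐ u ∂angularLaw s,
      ‖(-1 : ℝ) ^ n * (x * u) ^ (2 * n) / ((2 * n).factorial : ℝ)‖ ≤
        |x| ^ (2 * n) / ((2 * n).factorial : ℝ) := fun n => by
    filter_upwards [angularLaw_ae_mem (s := s)] with u hu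
    have hu' : |u| ≤ 1 := abs_le.2 hu
    rw [norm_div, norm_mul, norm_pow, norm_pow, norm_neg, norm_one, one_pow, one_mul, norm_mul,
      Real.norm_eq_abs, Real.norm_eq_abs, Real.norm_eq_abs, Nat.abs_cast]
    gcongr
    exact mul_le_of_le_one_right (abs_nonneg _) hu'
  have hmeas : ∀ n : ℕ, AEStronglyMeasurable
      (fun u : ℝ => (-1 : ℝ) ^ n * (x * u) ^ (2 * n) / ((2 * n).factorial : ℝ)) (angularLaw s) :=
    fun n => Continuous.aestronglyMeasurable (by fun_prop)
  have h : HasSum (fun n : ℕ => ∫ u : ℝ, (-1 : ℝ) ^ n * (x * u) ^ (2 * n) /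
      ((2 * n).factorial : ℝ) ∂angularLaw s) (∫ u, Real.cos (x * u) ∂angularLaw s) :=
    hasSum_integral_of_dominated_convergence
      (fun (n : ℕ) (_ : ℝ) => |x| ^ (2 * n) / ((2 * n).factorial : ℝ)) hmeas hbound
      (ae_of_all _ fun _ => hsum) (integrable_const _) (ae_of_all _ fun u => Real.hasSum_cos (x * u))
  rw [bigLam_eq_lamSeries hs, ← h.tsum_eq]
  refine tsum_congr fun n => ?_
  have e : ∀ u : ℝ, (-1 : ℝ) ^ n * (x * u) ^ (2 * n) / ((2 * n).factorial : ℝ) =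
      (-1) ^ n * x ^ (2 * n) / (2 * n).factorial * u ^ (2 * n) := fun u => by
    rw [mul_pow]
    ring
  simp only [e]
  rw [integral_const_mul, integral_pow_even_angularLaw hs, lamCoeff]
  have h1 := (rising_pos (show 0 < s + 1 by linarith) n).ne'
  rw [neg_pow (x ^ 2 / 4), div_pow, ← pow_mul]
  have h2 : ((2 * n).factorial : ℝ) ≠ 0 := by positivity
  generalize ((2 * n).factorial : ℝ) = f at *
  field_simp

theorem integrable_angularLaw_of_abs_le {s : ℝ} (hs : -1 / 2 ≤ s) {f : ℝ → ℝ} (hf : Measurable f)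
    (C : ℝ) (h : ∀ u ∈ Icc (-1 : ℝ) 1, |f u| ≤ C) : Integrable f (angularLaw s) := by
  have := isProbabilityMeasure_angularLaw hs
  refine Integrable.of_bound hf.aestronglyMeasurable C ?_
  filter_upwards [angularLaw_ae_mem (s := s)] with u hu using h u hu

/-- The sine part vanishes by symmetry. The exponential form is needed because, unlike the cosine,
it factors over coordinates. -/
theorem integral_cexp_angularLaw {s : ℝ} (hs : -1 / 2 ≤ s) (x : ℝ) :
    ∫ u, Complex.exp ((x * u : ℝ) * Complex.I) ∂angularLaw s = bigLam s x := by
  have hc : Integrable (fun u : ℝ => Real.cos (x * u)) (angularLaw s) :=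
    integrable_angularLaw_of_abs_le hs (by fun_prop) 1 fun u _ => Real.abs_cos_le_one _
  have hsin : Integrable (fun u : ℝ => Real.sin (x * u)) (angularLaw s) :=
    integrable_angularLaw_of_abs_le hs (by fun_prop) 1 fun u _ => Real.abs_sin_le_one _
  have e : ∀ u : ℝ, Complex.exp ((x * u : ℝ) * Complex.I) =
      (Real.cos (x * u) : ℂ) + (Real.sin (x * u) : ℂ) * Complex.I := fun u => by
    rw [Complex.exp_mul_I, Complex.ofReal_cos, Complex.ofReal_sin]
  simp only [e]
  rw [integral_add hc.ofReal (hsin.ofReal.mul_const _), integral_mul_const, integral_complex_ofReal,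
    integral_complex_ofReal, integral_cos_angularLaw hs,
    integral_odd_angularLaw s hs (f := fun u => Real.sin (x * u)) (fun u => by simp)]
  simp

theorem abs_bigLam_le_one {s : ℝ} (hs : -1 / 2 ≤ s) (x : ℝ) : |bigLam s x| ≤ 1 := by
  have := isProbabilityMeasure_angularLaw hs
  rw [← integral_cos_angularLaw hs, ← Real.norm_eq_abs]
  have := norm_integral_le_of_norm_le_const (μ := angularLaw s) (f := fun u => Real.cos (x * u))
    (C := 1) (ae_of_all _ fun u => Real.abs_cos_le_one _)
  simpa using this

theorem one_sub_bigLam_nonneg {s : ℝ} (hs : -1 / 2 ≤ s) (x : ℝ) : 0 ≤ 1 - bigLam s x :=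
  sub_nonneg.2 (abs_le.1 (abs_bigLam_le_one hs x)).2

theorem one_sub_bigLam_le_two {s : ℝ} (hs : -1 / 2 ≤ s) (x : ℝ) : 1 - bigLam s x ≤ 2 := by
  linarith [(abs_le.1 (abs_bigLam_le_one hs x)).1]

theorem one_sub_bigLam_le_sq {s : ℝ} (hs : -1 / 2 ≤ s) (x : ℝ) : 1 - bigLam s x ≤ x ^ 2 / 2 := by
  have := isProbabilityMeasure_angularLaw hs
  have h1 : ∫ u, (1 - x ^ 2 / 2) ∂angularLaw s ≤ ∫ u, Real.cos (x * u) ∂angularLaw s := by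
    refine integral_mono_ae (integrable_const _)
      (integrable_angularLaw_of_abs_le hs (by fun_prop) 1 fun u _ => Real.abs_cos_le_one _) ?_
    filter_upwards [angularLaw_ae_mem (s := s)] with u hu
    have h2 : u ^ 2 ≤ 1 := by nlinarith [hu.1, hu.2]
    have h3 := Real.one_sub_sq_div_two_le_cos (x := x * u)
    have h4 : (x * u) ^ 2 ≤ x ^ 2 := by nlinarith [sq_nonneg x]
    linarith
  rw [integral_cos_angularLaw hs] at h1
  simp at h1
  linarith

/-! ### The second-order quotient of the kernel at the origin -/

/-- The continuous extension of `(1 - Λ_s(z)) / z²`. -/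
noncomputable def lamQuot (s z : ℝ) : ℝ :=
  (∑' n : ℕ, lamCoeff s (n + 1) * (-(z ^ 2 / 4)) ^ n) / 4

theorem abs_lamCoeff_succ_le {s : ℝ} (hs : -1 / 2 ≤ s) (n : ℕ) :
    |lamCoeff s (n + 1)| ≤ 2 / n.factorial := by
  refine (abs_lamCoeff_le hs _).trans ?_
  gcongr
  omega

theorem continuous_lamQuot {s : ℝ} (hs : -1 / 2 ≤ s) : Continuous (lamQuot s) := by
  unfold lamQuot
  have h := (continuous_tsum_mul_pow (abs_lamCoeff_succ_le hs)).comp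
    (show Continuous fun z : ℝ => -(z ^ 2 / 4) by fun_prop)
  exact h.div_const 4

theorem one_sub_bigLam {s : ℝ} (hs : -1 / 2 ≤ s) (z : ℝ) :
    1 - bigLam s z = z ^ 2 * lamQuot s z := by
  have h0 : lamCoeff s 0 = 1 := by simp [lamCoeff]
  rw [bigLam_eq_lamSeries hs, lamSeries,
    (summable_lamSeries hs (-(z ^ 2 / 4))).of_norm.tsum_eq_zero_add, lamQuot, h0]
  simp only [pow_succ]
  simp only [← mul_assoc]
  rw [tsum_mul_right]
  ring

/-- The value at `0` of `(1 - Λ_s(z)) / z²`. -/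
noncomputable def curv (s : ℝ) : ℝ := 1 / (4 * (s + 1))

theorem curv_pos {s : ℝ} (hs : -1 / 2 ≤ s) : 0 < curv s := by
  have : 0 < s + 1 := by linarith
  unfold curv
  positivity

theorem lamQuot_zero (s : ℝ) : lamQuot s 0 = curv s := by
  rw [lamQuot, tsum_eq_single 0]
  · simp [lamCoeff, rising, curv]
    ring
  · intro n hn
    simp [hn]

theorem lamQuot_nonneg {s : ℝ} (hs : -1 / 2 ≤ s) (z : ℝ) : 0 ≤ lamQuot s z := by
  rcases eq_or_ne z 0 with rfl | hz
  · rw [lamQuot_zero]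
    exact (curv_pos hs).le
  · have h := one_sub_bigLam_nonneg hs z
    rw [one_sub_bigLam hs] at h
    exact nonneg_of_mul_nonneg_right h (by positivity)

theorem lamQuot_le {s : ℝ} (hs : -1 / 2 ≤ s) (z : ℝ) : lamQuot s z ≤ 1 / 2 := by
  rcases eq_or_ne z 0 with rfl | hz
  · rw [lamQuot_zero, curv, div_le_div_iff₀ (by linarith) (by norm_num)]
    linarith
  · have h := one_sub_bigLam_le_sq hs z
    rw [one_sub_bigLam hs] at h
    have : 0 < z ^ 2 := by positivity
    nlinarith

/-! ### Sonine's product formula -/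

theorem sum_range_two_mul_of_odd_eq_zero {f : ℕ → ℝ} (hf : ∀ n, f (2 * n + 1) = 0) (N : ℕ) :
    ∑ m ∈ Finset.range (2 * N), f m = ∑ l ∈ Finset.range N, f (2 * l) := by
  induction N with
  | zero => simp
  | succ N ih =>
    rw [show 2 * (N + 1) = 2 * N + 1 + 1 by ring, Finset.sum_range_succ, Finset.sum_range_succ, ih,
      hf, add_zero, Finset.sum_range_succ]

/-- Expand in powers of `u`: odd moments vanish and even ones are known. The coefficient of `x^(2p)
y^(2q)` is then a sum over `l`, which Chu–Vandermonde evaluates. -/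
theorem integral_add_mul_pow_angularLaw {s : ℝ} (hs : -1 / 2 ≤ s) (x y : ℝ) (n : ℕ) :
    ∫ u, (x ^ 2 + 2 * u * x * y + y ^ 2) ^ n ∂angularLaw s =
      ∑ p ∈ Finset.HasAntidiagonal.antidiagonal n, n.factorial * rising (s + 1) n /
        (p.1.factorial * p.2.factorial * (rising (s + 1) p.1 * rising (s + 1) p.2)) *
          (x ^ (2 * p.1) * y ^ (2 * p.2)) := by
  have hc : 0 < s + 1 := by linarith
  have hfac : ∀ m : ℕ, (m.factorial : ℝ) ≠ 0 := fun m => by positivity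
  -- The binomial sum is padded with zero terms up to `2(n+1)` so that its indices split into even
  -- and odd ones in pairs.
  have h1 : ∀ u : ℝ, (x ^ 2 + 2 * u * x * y + y ^ 2) ^ n =
      ∑ m ∈ Finset.range (2 * (n + 1)),
        (n.choose m * (2 * x * y) ^ m * (x ^ 2 + y ^ 2) ^ (n - m)) * u ^ m := fun u => by
    rw [show x ^ 2 + 2 * u * x * y + y ^ 2 = 2 * u * x * y + (x ^ 2 + y ^ 2) by ring, add_pow]
    refine Finset.sum_subset_zero_on_sdiff ?_ ?_ ?_
    · intro m hm
      simp only [Finset.mem_range] at hm ⊢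
      omega
    · intro m hm
      simp only [Finset.mem_sdiff, Finset.mem_range] at hm
      rw [Nat.choose_eq_zero_of_lt (by omega)]
      simp
    · intro m _
      rw [show 2 * u * x * y = (2 * x * y) * u by ring, mul_pow]
      ring
  have hint : ∀ m : ℕ, Integrable (fun u : ℝ => u ^ m) (angularLaw s) := fun m =>
    integrable_angularLaw_of_abs_le hs (by fun_prop) 1 fun u hu => by
      rw [abs_pow]
      exact pow_le_one₀ (abs_nonneg _) (abs_le.2 hu)
  simp only [h1]
  rw [integral_finsetSum _ fun m _ => (hint m).const_mul _]
  simp only [integral_const_mul]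
  rw [sum_range_two_mul_of_odd_eq_zero fun l => by
    rw [integral_odd_angularLaw s hs fun u => (Odd.neg_pow ⟨l, rfl⟩ u), mul_zero]]
  -- The factor `(xy)^(2l)` contributes `l` to each of the exponents `q.1` and `q.2`; the remaining
  -- binomial expansion distributes `n - 2l`. If `2l > n`, both sides are zero.
  have h2 : ∀ l ∈ Finset.range (n + 1),
      (n.choose (2 * l) : ℝ) * (2 * x * y) ^ (2 * l) * (x ^ 2 + y ^ 2) ^ (n - 2 * l) *
        ∫ u, u ^ (2 * l) ∂angularLaw s =
      ∑ q ∈ (Finset.HasAntidiagonal.antidiagonal n).filter (fun q => l ≤ q.1 ∧ l ≤ q.2),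
        n.factorial / ((q.1 - l).factorial * (q.2 - l).factorial * (l.factorial *
          rising (s + 1) l)) * (x ^ (2 * q.1) * y ^ (2 * q.2)) := by
    intro l _
    rw [integral_pow_even_angularLaw hs]
    by_cases hl : 2 * l ≤ n
    · rw [add_comm (x ^ 2), add_pow, Finset.mul_sum, Finset.sum_mul]
      refine Finset.sum_bij' (fun i _ => (n - l - i, i + l)) (fun q _ => q.2 - l) ?_ ?_ ?_ ?_ ?_
      · intro i hi
        simp only [Finset.mem_range, Finset.mem_filter, Finset.HasAntidiagonal.mem_antidiagonal] at hi ⊢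
        omega
      · intro q hq
        simp only [Finset.mem_range, Finset.mem_filter, Finset.HasAntidiagonal.mem_antidiagonal] at hq ⊢
        omega
      · intro i hi
        simp
      · intro q hq
        simp only [Finset.mem_filter, Finset.HasAntidiagonal.mem_antidiagonal] at hq
        ext <;> simp only <;> omega
      · intro i hi
        simp only [Finset.mem_range] at hi
        have hi' : i ≤ n - 2 * l := by omega
        have e1 : n - l - i - l = n - 2 * l - i := by omega
        have e2 : i + l - l = i := by omega
        simp only [e1, e2]
        have e3 : 2 * (n - l - i) = 2 * (n - 2 * l - i) + 2 * l := by omega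
        rw [e3, Nat.cast_choose ℝ hl, Nat.cast_choose ℝ hi', mul_add 2 i l, pow_add x, pow_add y,
          mul_assoc 2 x y, mul_pow 2, mul_pow x, pow_mul 2 2 l, ← pow_mul x 2, ← pow_mul y 2]
        have hp := (rising_pos hc l).ne'
        have := hfac (2 * l)
        have := hfac (n - 2 * l)
        have := hfac (n - 2 * l - i)
        have := hfac i
        have := hfac l
        norm_num
        field_simp
    · rw [Nat.choose_eq_zero_of_lt (by omega)]
      rw [Finset.sum_eq_zero]
      · simp
      · intro q hq
        simp only [Finset.mem_filter, Finset.HasAntidiagonal.mem_antidiagonal] at hq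
        omega
  rw [Finset.sum_congr rfl h2]
  simp only [Finset.sum_filter]
  -- With the pair `q` outside, the inner sum over `l` is the expansion in `rising_add_div`; its
  -- terms with `l > q.2` vanish because the descending factorial does.
  rw [Finset.sum_comm]
  refine Finset.sum_congr rfl fun q hq => ?_
  rw [Finset.HasAntidiagonal.mem_antidiagonal] at hq
  have h3 : (n.factorial : ℝ) * rising (s + 1) n /
        (q.1.factorial * q.2.factorial * (rising (s + 1) q.1 * rising (s + 1) q.2)) =
      n.factorial / (q.1.factorial * q.2.factorial) *
        (rising (s + 1) (q.1 + q.2) / (rising (s + 1) q.1 * rising (s + 1) q.2)) := by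
    rw [hq, div_mul_div_comm]
  rw [h3, rising_add_div hc, Finset.mul_sum, Finset.sum_mul]
  symm
  refine Finset.sum_subset_zero_on_sdiff ?_ ?_ ?_
  · intro l hl
    simp only [Finset.mem_range] at hl ⊢
    omega
  · intro l hl
    simp only [Finset.mem_sdiff, Finset.mem_range] at hl
    rw [if_neg (by omega)]
  · intro l hl
    simp only [Finset.mem_range] at hl
    have hl1 : l ≤ q.1 := by omega
    split_ifs with hl2
    · rw [Nat.cast_choose ℝ hl1]
      have h4 : (q.2.descFactorial l : ℝ) = q.2.factorial / (q.2 - l).factorial := by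
        rw [eq_div_iff (hfac _), mul_comm]
        exact_mod_cast Nat.factorial_mul_descFactorial hl2.2
      rw [h4]
      have hp := (rising_pos hc l).ne'
      have := hfac q.1
      have := hfac q.2
      have := hfac l
      have := hfac (q.1 - l)
      have := hfac (q.2 - l)
      field_simp
    · rw [Nat.descFactorial_eq_zero_iff_lt.2 (by omega)]
      simp

theorem add_two_mul_add_sq_nonneg {u : ℝ} (hu : u ∈ Icc (-1 : ℝ) 1) {x y : ℝ} (hx : 0 ≤ x)
    (hy : 0 ≤ y) : 0 ≤ x ^ 2 + 2 * u * x * y + y ^ 2 := by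
  nlinarith [mul_nonneg hx hy, hu.1, sq_nonneg (x - y)]

theorem sq_add_le {u : ℝ} (hu : u ∈ Icc (-1 : ℝ) 1) {x y : ℝ} (hx : 0 ≤ x)
    (hy : 0 ≤ y) : x ^ 2 + 2 * u * x * y + y ^ 2 ≤ (x + y) ^ 2 := by
  nlinarith [mul_nonneg hx hy, hu.2]

theorem triangle_sq {u : ℝ} (hu : u ∈ Icc (-1 : ℝ) 1) (x y : ℝ≥0) :
    (triangle u x y : ℝ) ^ 2 = (x : ℝ) ^ 2 + 2 * u * x * y + (y : ℝ) ^ 2 := by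
  rw [triangle, Real.coe_toNNReal _ (Real.sqrt_nonneg _),
    Real.sq_sqrt (add_two_mul_add_sq_nonneg hu x.coe_nonneg y.coe_nonneg)]

/-- Sonine's product formula for the kernel `Λ_s`. -/
theorem integral_bigLam_triangle {s : ℝ} (hs : -1 / 2 ≤ s) (t x y : ℝ≥0) :
    ∫ u, bigLam s (t * triangle u x y) ∂angularLaw s = bigLam s (t * x) * bigLam s (t * y) := by
  have := isProbabilityMeasure_angularLaw hs
  have h0 : ∫ u, bigLam s (t * triangle u x y) ∂angularLaw s =
      ∫ u, lamSeries s (-(((t * x : ℝ) ^ 2 + 2 * u * (t * x) * (t * y) + (t * y : ℝ) ^ 2) / 4))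
        ∂angularLaw s := by
    refine integral_congr_ae ?_
    filter_upwards [angularLaw_ae_mem (s := s)] with u hu
    rw [bigLam_eq_lamSeries hs, mul_pow, triangle_sq hu]
    congr 1
    ring
  set a : ℝ := t * x with ha
  set b : ℝ := t * y with hb
  have ha0 : 0 ≤ a := by positivity
  have hb0 : 0 ≤ b := by positivity
  clear_value a b
  have h := integral_lamSeries hs (μ := angularLaw s)
    (z := fun u => -((a ^ 2 + 2 * u * a * b + b ^ 2) / 4)) (by fun_prop) (R := (a + b) ^ 2 / 4) (by
      filter_upwards [angularLaw_ae_mem (s := s)] with u hu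
      rw [abs_neg, abs_of_nonneg (by linarith [add_two_mul_add_sq_nonneg hu ha0 hb0])]
      linarith [sq_add_le hu ha0 hb0])
  -- The right side is a Cauchy product, and its `n`-th term is compared with the integral of the
  -- `n`-th power of the squared triangle side.
  rw [h0, ← h.tsum_eq, bigLam_eq_lamSeries hs, bigLam_eq_lamSeries hs, lamSeries, lamSeries,
    tsum_mul_tsum_eq_tsum_sum_antidiagonal_of_summable_norm (summable_lamSeries hs _)
      (summable_lamSeries hs _)]
  refine tsum_congr fun n => ?_
  have e : ∀ u : ℝ, (-((a ^ 2 + 2 * u * a * b + b ^ 2) / 4)) ^ n =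
      (-1 / 4) ^ n * (a ^ 2 + 2 * u * a * b + b ^ 2) ^ n := fun u => by
    rw [← mul_pow]
    congr 1
    ring
  simp only [e]
  rw [integral_const_mul, integral_add_mul_pow_angularLaw hs, Finset.mul_sum, Finset.mul_sum]
  refine Finset.sum_congr rfl fun p hp => ?_
  rw [Finset.HasAntidiagonal.mem_antidiagonal] at hp
  have hc : 0 < s + 1 := by linarith
  have h1 := (rising_pos hc n).ne'
  have h2 := (rising_pos hc p.1).ne'
  have h3 := (rising_pos hc p.2).ne'
  have e1 : -(a ^ 2 / 4) = (-1 / 4) * a ^ 2 := by ring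
  have e2 : -(b ^ 2 / 4) = (-1 / 4) * b ^ 2 := by ring
  have e3 : (-1 / 4 : ℝ) ^ n = (-1 / 4) ^ p.1 * (-1 / 4) ^ p.2 := by rw [← pow_add, hp]
  rw [e1, e2, mul_pow, mul_pow, e3, pow_mul a, pow_mul b, lamCoeff, lamCoeff, lamCoeff]
  generalize (-1 / 4 : ℝ) ^ p.1 = A
  generalize (-1 / 4 : ℝ) ^ p.2 = B
  field_simp

/-! ### The Rayleigh law and its Gaussian transform -/

theorem integral_rayleigh {s : ℝ} (hs : -1 / 2 ≤ s) {f : ℝ → ℝ} (hf : Measurable f) :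
    ∫ y : ℝ≥0, f y ∂rayleigh s = 2 * (s + 1) ^ (s + 1) / Real.Gamma (s + 1) *
      ∫ y in Ioi (0 : ℝ), f y * (y ^ (2 * s + 1) * Real.exp (-(s + 1) * y ^ 2)) := by
  have hs1 : 0 < s + 1 := by linarith
  have hG := Real.Gamma_pos_of_pos hs1
  rw [rayleigh, integral_map (by fun_prop)
    (by exact (hf.comp measurable_coe_nnreal_real).aestronglyMeasurable),
    integral_withDensity_eq_integral_toReal_smul (by fun_prop)
    (ae_of_all _ fun _ => ENNReal.ofReal_lt_top), ← integral_const_mul]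
  refine setIntegral_congr_fun measurableSet_Ioi fun y hy => ?_
  have hy : (0 : ℝ) < y := hy
  simp only [smul_eq_mul]
  rw [ENNReal.toReal_ofReal (by positivity), Real.coe_toNNReal _ hy.le]
  ring

theorem integral_pow_rayleigh {s : ℝ} (hs : -1 / 2 ≤ s) (n : ℕ) :
    ∫ y : ℝ≥0, (y : ℝ) ^ (2 * n) ∂rayleigh s = rising (s + 1) n / (s + 1) ^ n := by
  have hs1 : 0 < s + 1 := by linarith
  have hG := Real.Gamma_pos_of_pos hs1
  have hn : (0 : ℝ) ≤ n := Nat.cast_nonneg n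
  have h := integral_rpow_mul_exp_neg_mul_rpow (p := 2) (q := 2 * s + 1 + 2 * n) (b := s + 1)
    (by norm_num) (by linarith) hs1
  rw [integral_rayleigh hs (f := fun y => y ^ (2 * n)) (by fun_prop)]
  have h2 : ∫ y in Ioi (0 : ℝ), y ^ (2 * n) * (y ^ (2 * s + 1) * Real.exp (-(s + 1) * y ^ 2)) =
      ∫ y in Ioi (0 : ℝ), y ^ (2 * s + 1 + 2 * n) * Real.exp (-(s + 1) * y ^ (2 : ℝ)) := by
    refine setIntegral_congr_fun measurableSet_Ioi fun y hy => ?_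
    have hy : (0 : ℝ) < y := hy
    rw [Real.rpow_add hy (2 * s + 1), Real.rpow_two, show (2 * (n : ℝ)) = ((2 * n : ℕ) : ℝ) by push_cast; ring,
      Real.rpow_natCast]
    ring
  have e1 : (2 * s + 1 + 2 * n + 1) / 2 = s + 1 + n := by ring
  rw [h2, h, neg_div, e1, Gamma_add_natCast hs1, Real.rpow_neg hs1.le,
    Real.rpow_add hs1 (s + 1), Real.rpow_natCast]
  have := Real.rpow_pos_of_pos hs1 (s + 1)
  field_simp

theorem isProbabilityMeasure_rayleigh {s : ℝ} (hs : -1 / 2 ≤ s) :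
    IsProbabilityMeasure (rayleigh s) := by
  have h := integral_pow_rayleigh hs 0
  simp only [mul_zero, pow_zero, integral_const, smul_eq_mul, mul_one, rising_zero, div_one] at h
  refine ⟨?_⟩
  rw [Measure.real, ENNReal.toReal_eq_one_iff] at h
  exact h

theorem integrable_pow_rayleigh {s : ℝ} (hs : -1 / 2 ≤ s) (n : ℕ) :
    Integrable (fun y : ℝ≥0 => (y : ℝ) ^ (2 * n)) (rayleigh s) := by
  by_contra h
  have h1 := integral_pow_rayleigh hs n
  rw [integral_undef h] at h1
  have hs1 : 0 < s + 1 := by linarith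
  have := rising_pos hs1 n
  have : 0 < rising (s + 1) n / (s + 1) ^ n := by positivity
  linarith

theorem integral_sq_rayleigh {s : ℝ} (hs : -1 / 2 ≤ s) :
    ∫ y : ℝ≥0, (y : ℝ) ^ 2 ∂rayleigh s = 1 := by
  have h := integral_pow_rayleigh hs 1
  have hs1 : 0 < s + 1 := by linarith
  simpa [rising, hs1.ne'] using h

/-- The `2n`-th moment `(s+1)_n/(s+1)^n` cancels the rising factorial in `lamCoeff`, leaving the
exponential series. Since `σ_s` has unbounded support, `integral_lamSeries` does not apply; the
termwise integration rests on summability of the integrated norms. -/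
theorem integral_bigLam_rayleigh {s : ℝ} (hs : -1 / 2 ≤ s) (x : ℝ) :
    ∫ y : ℝ≥0, bigLam s (x * y) ∂rayleigh s = Real.exp (-(curv s * x ^ 2)) := by
  have hs1 : 0 < s + 1 := by linarith
  have e : ∀ (n : ℕ) (y : ℝ≥0), lamCoeff s n * (-((x * y) ^ 2 / 4)) ^ n =
      lamCoeff s n * (-(x ^ 2 / 4)) ^ n * (y : ℝ) ^ (2 * n) := fun n y => by
    rw [pow_mul (y : ℝ) 2 n, mul_assoc, ← mul_pow]
    congr 2
    ring
  have hI : ∀ n : ℕ, ∫ y : ℝ≥0, lamCoeff s n * (-((x * y) ^ 2 / 4)) ^ n ∂rayleigh s =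
      (-(curv s * x ^ 2)) ^ n / n.factorial := fun n => by
    simp only [e]
    rw [integral_const_mul, integral_pow_rayleigh hs, lamCoeff, curv]
    have hp := (rising_pos hs1 n).ne'
    have e2 : -(1 / (4 * (s + 1)) * x ^ 2) = -(x ^ 2 / 4) / (s + 1) := by field_simp
    rw [e2, div_pow]
    generalize (-(x ^ 2 / 4)) ^ n = A
    field_simp
  have hN : ∀ n : ℕ, ∫ y : ℝ≥0, ‖lamCoeff s n * (-((x * y) ^ 2 / 4)) ^ n‖ ∂rayleigh s =
      |curv s * x ^ 2| ^ n / n.factorial := fun n => by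
    have e3 : ∀ y : ℝ≥0, ‖lamCoeff s n * (-((x * y) ^ 2 / 4)) ^ n‖ =
        ‖lamCoeff s n * (-(x ^ 2 / 4)) ^ n‖ * (y : ℝ) ^ (2 * n) := fun y => by
      rw [e, norm_mul, Real.norm_of_nonneg (by positivity : 0 ≤ (y : ℝ) ^ (2 * n))]
    simp only [e3]
    rw [integral_const_mul, integral_pow_rayleigh hs]
    have h2 := hI n
    simp only [e] at h2
    rw [integral_const_mul, integral_pow_rayleigh hs] at h2
    have hp := rising_pos hs1 n
    have h3 : 0 ≤ rising (s + 1) n / (s + 1) ^ n := by positivity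
    rw [← Real.norm_of_nonneg h3, ← norm_mul, h2, norm_div, norm_pow,
      norm_neg, Real.norm_eq_abs, Real.norm_eq_abs, Nat.abs_cast]
  have h := hasSum_integral_of_summable_integral_norm (μ := rayleigh s)
    (F := fun (n : ℕ) (y : ℝ≥0) => lamCoeff s n * (-((x * y) ^ 2 / 4)) ^ n)
    (fun n => by
      simp only [e]
      exact (integrable_pow_rayleigh hs n).const_mul _)
    (by
      simp only [hN]
      exact Real.summable_pow_div_factorial _)
  simp only [hI] at h
  have h2 : Real.exp (-(curv s * x ^ 2)) = ∑' n : ℕ, (-(curv s * x ^ 2)) ^ n / n.factorial := by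
    rw [Real.exp_eq_exp_ℝ, NormedSpace.exp_eq_tsum_div]
  rw [h2, h.tsum_eq]
  exact integral_congr_ae (ae_of_all _ fun y => bigLam_eq_lamSeries hs _)

/-! ### The product kernel and multiplicativity of the radial characteristic function -/

variable {k : ℕ} {s : ℝ}

/-- The product kernel `∏ Λ_s(t_j x_j)` of the radial characteristic function. -/
noncomputable def lamProd (s : ℝ) (t x : Fin k → ℝ≥0) : ℝ := ∏ j, bigLam s ((t j : ℝ) * x j)

theorem continuous_lamProd_uncurry (hs : -1 / 2 ≤ s) :
    Continuous fun p : (Fin k → ℝ≥0) × (Fin k → ℝ≥0) => lamProd s p.1 p.2 := by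
  unfold lamProd
  exact continuous_finsetProd _ fun j _ => (continuous_bigLam hs).comp (by fun_prop)

theorem continuous_lamProd (hs : -1 / 2 ≤ s) (t : Fin k → ℝ≥0) : Continuous (lamProd s t) :=
  (continuous_lamProd_uncurry hs).comp (Continuous.prodMk_right t)

theorem abs_lamProd_le_one (hs : -1 / 2 ≤ s) (t x : Fin k → ℝ≥0) : |lamProd s t x| ≤ 1 := by
  rw [lamProd, Finset.abs_prod]
  exact Finset.prod_le_one (fun _ _ => abs_nonneg _) fun _ _ => abs_bigLam_le_one hs _

theorem lamProd_le_one (hs : -1 / 2 ≤ s) (t x : Fin k → ℝ≥0) : lamProd s t x ≤ 1 :=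
  (abs_le.1 (abs_lamProd_le_one hs t x)).2

theorem lamProd_zero_left (hs : -1 / 2 ≤ s) (x : Fin k → ℝ≥0) : lamProd s 0 x = 1 := by
  simp [lamProd, bigLam_zero hs]

theorem lamProd_zero_right (hs : -1 / 2 ≤ s) (t : Fin k → ℝ≥0) : lamProd s t 0 = 1 := by
  simp [lamProd, bigLam_zero hs]

theorem lamProd_single (hs : -1 / 2 ≤ s) (j : Fin k) (r : ℝ≥0) (x : Fin k → ℝ≥0) :
    lamProd s (Pi.single j r) x = bigLam s (r * x j) := by
  rw [lamProd, Finset.prod_eq_single j]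
  · simp
  · intro i _ hi
    simp [hi, bigLam_zero hs]
  · simp

theorem integrable_lamProd (hs : -1 / 2 ≤ s) (μ : Measure (Fin k → ℝ≥0)) [IsFiniteMeasure μ]
    (t : Fin k → ℝ≥0) : Integrable (lamProd s t) μ :=
  Integrable.of_bound (continuous_lamProd hs t).aestronglyMeasurable 1
    (ae_of_all _ fun x => abs_lamProd_le_one hs t x)

theorem radCF_eq (μ : Measure (Fin k → ℝ≥0)) (t : Fin k → ℝ≥0) :
    radCF s μ t = ∫ x, lamProd s t x ∂μ := rfl

theorem continuous_radCF (hs : -1 / 2 ≤ s) (μ : Measure (Fin k → ℝ≥0)) [IsFiniteMeasure μ] :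
    Continuous (radCF s μ) := by
  refine continuous_of_dominated (bound := fun _ => 1)
    (fun t => (continuous_lamProd hs t).aestronglyMeasurable)
    (fun t => ae_of_all _ fun x => abs_lamProd_le_one hs t x) (integrable_const _)
    (ae_of_all _ fun x => ?_)
  exact (continuous_lamProd_uncurry hs).comp (Continuous.prodMk_left x)

theorem radCF_zero (hs : -1 / 2 ≤ s) (μ : Measure (Fin k → ℝ≥0)) [IsProbabilityMeasure μ] :
    radCF s μ 0 = 1 := by
  simp [radCF_eq, lamProd_zero_left hs]

theorem one_sub_radCF (hs : -1 / 2 ≤ s) (μ : Measure (Fin k → ℝ≥0)) [IsProbabilityMeasure μ]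
    (t : Fin k → ℝ≥0) : 1 - radCF s μ t = ∫ x, (1 - lamProd s t x) ∂μ := by
  rw [integral_sub (integrable_const _) (integrable_lamProd hs μ t), radCF_eq]
  simp

theorem continuous_triangle_uncurry :
    Continuous fun p : ((Fin k → ℝ≥0) × (Fin k → ℝ≥0)) × (Fin k → ℝ) =>
      fun j => triangle (p.2 j) (p.1.1 j) (p.1.2 j) := by
  unfold triangle
  fun_prop

theorem isProbabilityMeasure_conv (hs : -1 / 2 ≤ s) (G₁ G₂ : Measure (Fin k → ℝ≥0))
    [IsProbabilityMeasure G₁] [IsProbabilityMeasure G₂] : IsProbabilityMeasure (conv s G₁ G₂) := by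
  have := isProbabilityMeasure_angularLaw hs
  exact Measure.isProbabilityMeasure_map continuous_triangle_uncurry.aemeasurable

/-- By Fubini the `u`-integral splits over the coordinates, and Sonine's formula evaluates each
factor. -/
theorem radCF_conv (hs : -1 / 2 ≤ s) (G₁ G₂ : Measure (Fin k → ℝ≥0))
    [IsProbabilityMeasure G₁] [IsProbabilityMeasure G₂] (t : Fin k → ℝ≥0) :
    radCF s (conv s G₁ G₂) t = radCF s G₁ t * radCF s G₂ t := by
  have := isProbabilityMeasure_angularLaw hs
  have hc : Continuous fun p : ((Fin k → ℝ≥0) × (Fin k → ℝ≥0)) × (Fin k → ℝ) =>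
      lamProd s t (fun j => triangle (p.2 j) (p.1.1 j) (p.1.2 j)) :=
    (continuous_lamProd hs t).comp continuous_triangle_uncurry
  rw [radCF_eq, conv, integral_map continuous_triangle_uncurry.aemeasurable
    (continuous_lamProd hs t).aestronglyMeasurable, integral_prod _
    (Integrable.of_bound hc.aestronglyMeasurable 1 (ae_of_all _ fun x => abs_lamProd_le_one hs t _))]
  have h : ∀ q : (Fin k → ℝ≥0) × (Fin k → ℝ≥0),
      ∫ u : Fin k → ℝ, lamProd s t (fun j => triangle (u j) (q.1 j) (q.2 j))
        ∂(Measure.pi fun _ => angularLaw s) = lamProd s t q.1 * lamProd s t q.2 := fun q => by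
    unfold lamProd
    rw [integral_fintype_prod_eq_prod (𝕜 := ℝ)
      (fun j u => bigLam s ((t j : ℝ) * triangle u (q.1 j) (q.2 j))), ← Finset.prod_mul_distrib]
    exact Finset.prod_congr rfl fun j _ => integral_bigLam_triangle hs _ _ _
  simp only [h]
  rw [integral_prod_mul (lamProd s t) (lamProd s t)]
  rfl

theorem isProbabilityMeasure_convPow (hs : -1 / 2 ≤ s) (G : Measure (Fin k → ℝ≥0))
    [IsProbabilityMeasure G] (m : ℕ) : IsProbabilityMeasure (convPow s G m) := by
  induction m with
  | zero => rw [convPow]; infer_instance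
  | succ m ih => rw [convPow]; exact isProbabilityMeasure_conv hs _ _

theorem radCF_convPow (hs : -1 / 2 ≤ s) (G : Measure (Fin k → ℝ≥0)) [IsProbabilityMeasure G]
    (m : ℕ) (t : Fin k → ℝ≥0) : radCF s (convPow s G m) t = radCF s G t ^ m := by
  induction m with
  | zero => rw [convPow, radCF_eq, integral_dirac, lamProd_zero_right hs, pow_zero]
  | succ m ih =>
    have := isProbabilityMeasure_convPow hs G m
    rw [convPow, radCF_conv hs, ih, pow_succ]

/-! ### Growth of the radial characteristic function under integer dilation -/

theorem abs_sin_natCast_mul_le (n : ℕ) (θ : ℝ) : |Real.sin (n * θ)| ≤ n * |Real.sin θ| := by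
  induction n with
  | zero => simp
  | succ n ih =>
    have e : ((n + 1 : ℕ) : ℝ) * θ = n * θ + θ := by push_cast; ring
    rw [e, Real.sin_add]
    calc |Real.sin (n * θ) * Real.cos θ + Real.cos (n * θ) * Real.sin θ|
        ≤ |Real.sin (n * θ)| * |Real.cos θ| + |Real.cos (n * θ)| * |Real.sin θ| := by
          rw [← abs_mul, ← abs_mul]
          exact abs_add_le _ _
      _ ≤ n * |Real.sin θ| * 1 + 1 * |Real.sin θ| := by
          gcongr
          · exact Real.abs_cos_le_one _
          · exact Real.abs_cos_le_one _
      _ = ((n + 1 : ℕ) : ℝ) * |Real.sin θ| := by push_cast; ring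

theorem one_sub_cos_natCast_mul_le (n : ℕ) (θ : ℝ) :
    1 - Real.cos (n * θ) ≤ n ^ 2 * (1 - Real.cos θ) := by
  have h : ∀ x : ℝ, 1 - Real.cos x = 2 * Real.sin (x / 2) ^ 2 := fun x => by
    have h1 := Real.cos_two_mul (x / 2)
    have h2 := Real.sin_sq_add_cos_sq (x / 2)
    rw [show 2 * (x / 2) = x by ring] at h1
    linarith
  rw [h, h, mul_div_assoc, ← sq_abs (Real.sin (n * (θ / 2))), ← sq_abs (Real.sin (θ / 2))]
  have := pow_le_pow_left₀ (abs_nonneg _) (abs_sin_natCast_mul_le n (θ / 2)) 2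
  nlinarith

/-- A product of characteristic functions is that of a sum of independent variables; being real, it
equals its real part. -/
theorem lamProd_eq_integral_cos (hs : -1 / 2 ≤ s) (t x : Fin k → ℝ≥0) :
    lamProd s t x = ∫ u : Fin k → ℝ, Real.cos (∑ j, (t j : ℝ) * x j * u j)
      ∂(Measure.pi fun _ => angularLaw s) := by
  have := isProbabilityMeasure_angularLaw hs
  have h := integral_fintype_prod_eq_prod (𝕜 := ℂ) (μ := fun _ : Fin k => angularLaw s)
    (fun j (u : ℝ) => Complex.exp (((t j : ℝ) * x j * u : ℝ) * Complex.I))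
  simp only [integral_cexp_angularLaw hs, ← Complex.exp_sum, ← Finset.sum_mul] at h
  have h2 := congrArg Complex.re h
  rw [← Complex.ofReal_prod, Complex.ofReal_re] at h2
  rw [lamProd, ← h2]
  have hint : Integrable (fun u : Fin k → ℝ => Complex.exp
      ((∑ j, ((t j * x j * u j : ℝ) : ℂ)) * Complex.I)) (Measure.pi fun _ => angularLaw s) := by
    refine Integrable.of_bound (Continuous.aestronglyMeasurable (by fun_prop)) 1
      (ae_of_all _ fun u => ?_)
    rw [← Complex.ofReal_sum, Complex.norm_exp_ofReal_mul_I]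
  have h3 := integral_re hint
  simp only [RCLike.re_eq_complex_re] at h3
  rw [← h3]
  refine integral_congr_ae (ae_of_all _ fun u => ?_)
  simp only
  rw [← Complex.ofReal_sum, Complex.exp_ofReal_mul_I_re]

/-- The inequality `1 - cos nθ ≤ n²(1 - cos θ)` averaged over the angles. It carries information
near `t = 0` to every `t`, uniformly in the measure. -/
theorem one_sub_lamProd_nsmul_le (hs : -1 / 2 ≤ s) (n : ℕ) (t x : Fin k → ℝ≥0) :
    1 - lamProd s (n • t) x ≤ n ^ 2 * (1 - lamProd s t x) := by
  have := isProbabilityMeasure_angularLaw hs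
  have hint : ∀ v : Fin k → ℝ≥0, Integrable (fun u : Fin k → ℝ =>
      Real.cos (∑ j, (v j : ℝ) * x j * u j)) (Measure.pi fun _ => angularLaw s) := fun v =>
    Integrable.of_bound (Continuous.aestronglyMeasurable (by fun_prop)) 1
      (ae_of_all _ fun u => Real.abs_cos_le_one _)
  have h : ∀ v : Fin k → ℝ≥0, 1 - lamProd s v x =
      ∫ u : Fin k → ℝ, (1 - Real.cos (∑ j, (v j : ℝ) * x j * u j))
        ∂(Measure.pi fun _ => angularLaw s) := fun v => by
    rw [integral_sub (integrable_const _) (hint v), lamProd_eq_integral_cos hs]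
    simp
  rw [h, h, ← integral_const_mul]
  refine integral_mono ((integrable_const _).sub (hint _))
    (((integrable_const _).sub (hint _)).const_mul _) fun u => ?_
  have e : ∑ j, (((n • t) j : ℝ≥0) : ℝ) * x j * u j = n * ∑ j, (t j : ℝ) * x j * u j := by
    rw [Finset.mul_sum]
    refine Finset.sum_congr rfl fun j _ => ?_
    simp
    ring
  simp only [e]
  exact one_sub_cos_natCast_mul_le n _

theorem one_sub_radCF_nsmul_le (hs : -1 / 2 ≤ s) (μ : Measure (Fin k → ℝ≥0))
    [IsProbabilityMeasure μ] (n : ℕ) (t : Fin k → ℝ≥0) :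
    1 - radCF s μ (n • t) ≤ n ^ 2 * (1 - radCF s μ t) := by
  rw [one_sub_radCF hs, one_sub_radCF hs, ← integral_const_mul]
  exact integral_mono ((integrable_const _).sub (integrable_lamProd hs μ _))
    (((integrable_const _).sub (integrable_lamProd hs μ _)).const_mul _)
    fun x => one_sub_lamProd_nsmul_le hs n t x

/-! ### Laplace transforms and injectivity of the radial characteristic function -/

/-- The bounded continuous function `x ↦ exp (-∑ n_j x_j²)`. -/
noncomputable def laplaceFun (n : Fin k → ℕ) : BoundedContinuousFunction (Fin k → ℝ≥0) ℝ :=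
  BoundedContinuousFunction.ofNormedAddCommGroup
    (fun x => Real.exp (-∑ j, (n j : ℝ) * (x j : ℝ) ^ 2)) (by fun_prop) 1 fun x => by
      rw [Real.norm_of_nonneg (Real.exp_pos _).le, Real.exp_le_one_iff, neg_nonpos]
      exact Finset.sum_nonneg fun j _ => by positivity

theorem laplaceFun_apply (n : Fin k → ℕ) (x : Fin k → ℝ≥0) :
    laplaceFun n x = Real.exp (-∑ j, (n j : ℝ) * (x j : ℝ) ^ 2) := rfl

theorem laplaceFun_add (m n : Fin k → ℕ) : laplaceFun (m + n) = laplaceFun m * laplaceFun n := by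
  ext x
  rw [BoundedContinuousFunction.mul_apply, laplaceFun_apply, laplaceFun_apply, laplaceFun_apply,
    ← Real.exp_add, ← neg_add, ← Finset.sum_add_distrib]
  congr 2
  exact Finset.sum_congr rfl fun j _ => by simp; ring

theorem laplaceFun_zero : laplaceFun (0 : Fin k → ℕ) = 1 := by
  ext x
  simp [laplaceFun_apply]

theorem span_laplaceFun_mul_mem {f g : BoundedContinuousFunction (Fin k → ℝ≥0) ℝ}
    (hf : f ∈ Submodule.span ℝ (range (laplaceFun (k := k))))
    (hg : g ∈ Submodule.span ℝ (range (laplaceFun (k := k)))) :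
    f * g ∈ Submodule.span ℝ (range (laplaceFun (k := k))) := by
  have h := Submodule.mul_mem_mul hf hg
  rw [Submodule.span_mul_span] at h
  refine Submodule.span_mono ?_ h
  rintro _ ⟨_, ⟨m, rfl⟩, _, ⟨n, rfl⟩, rfl⟩
  exact ⟨m + n, laplaceFun_add m n⟩

/-- The algebra of linear combinations of the functions `x ↦ exp (-∑ n_j x_j²)`. -/
noncomputable def laplaceAlg (k : ℕ) :
    StarSubalgebra ℝ (BoundedContinuousFunction (Fin k → ℝ≥0) ℝ) where
  carrier := Submodule.span ℝ (range (laplaceFun (k := k)))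
  mul_mem' := span_laplaceFun_mul_mem
  add_mem' := Submodule.add_mem _
  algebraMap_mem' r := by
    rw [Algebra.algebraMap_eq_smul_one]
    exact Submodule.smul_mem _ _ (Submodule.subset_span ⟨0, laplaceFun_zero⟩)
  star_mem' {f} hf := by
    have : star f = f := by ext x; simp
    rwa [this]

/-- A finite measure on the cone is determined by the Laplace transform of its image under
coordinatewise squaring, at integer points. -/
theorem ext_of_integral_laplaceFun {P P' : Measure (Fin k → ℝ≥0)} [IsFiniteMeasure P]
    [IsFiniteMeasure P'] (h : ∀ n : Fin k → ℕ, ∫ x, laplaceFun n x ∂P = ∫ x, laplaceFun n x ∂P') :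
    P = P' := by
  refine ext_of_forall_mem_subalgebra_integral_eq_of_polish (𝕜 := ℝ) (A := laplaceAlg k) ?_ ?_
  · intro x y hxy
    obtain ⟨j, hj⟩ := Function.ne_iff.1 hxy
    refine ⟨laplaceFun (Pi.single j 1), ⟨_, ⟨laplaceFun (Pi.single j 1),
      Submodule.subset_span ⟨_, rfl⟩, rfl⟩, rfl⟩, fun he => hj ?_⟩
    rw [laplaceFun_apply, laplaceFun_apply, Real.exp_eq_exp, neg_inj,
      Finset.sum_eq_single j (fun i _ hi => by simp [hi]) (by simp),
      Finset.sum_eq_single j (fun i _ hi => by simp [hi]) (by simp)] at he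
    simpa using he
  · intro g hg
    have hg' : g ∈ Submodule.span ℝ (range (laplaceFun (k := k))) := hg
    induction hg' using Submodule.span_induction with
    | mem g hg' =>
      obtain ⟨n, rfl⟩ := hg'
      exact h n
    | zero => simp
    | add f g hf' hg' ihf ihg =>
      simp only [BoundedContinuousFunction.add_apply]
      rw [integral_add (f.integrable P) (g.integrable P),
        integral_add (f.integrable P') (g.integrable P'), ihf hf', ihg hg']
    | smul r f hf' ihf =>
      simp only [BoundedContinuousFunction.smul_apply]
      rw [integral_smul, integral_smul, ihf hf']

/-- The law of a vector of independent rescaled Rayleigh variables. -/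
noncomputable def rayleighProd (s : ℝ) (c : Fin k → ℝ≥0) : Measure (Fin k → ℝ≥0) :=
  Measure.pi fun j => (rayleigh s).map fun y => c j * y

theorem isProbabilityMeasure_map_rayleigh (hs : -1 / 2 ≤ s) (c : ℝ≥0) :
    IsProbabilityMeasure ((rayleigh s).map fun y => c * y) := by
  have := isProbabilityMeasure_rayleigh hs
  exact Measure.isProbabilityMeasure_map (by fun_prop)

theorem isProbabilityMeasure_rayleighProd (hs : -1 / 2 ≤ s) (c : Fin k → ℝ≥0) :
    IsProbabilityMeasure (rayleighProd s c) := by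
  have := fun j => isProbabilityMeasure_map_rayleigh hs (c j)
  unfold rayleighProd
  infer_instance

theorem lamProd_comm (t x : Fin k → ℝ≥0) : lamProd s t x = lamProd s x t :=
  Finset.prod_congr rfl fun j _ => by rw [mul_comm]

theorem radCF_rayleighProd (hs : -1 / 2 ≤ s) (c t : Fin k → ℝ≥0) :
    radCF s (rayleighProd s c) t = Real.exp (-(curv s * ∑ j, (c j : ℝ) ^ 2 * (t j : ℝ) ^ 2)) := by
  have := fun j => isProbabilityMeasure_map_rayleigh hs (c j)
  rw [radCF, rayleighProd, integral_fintype_prod_eq_prod (𝕜 := ℝ)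
    (fun j (y : ℝ≥0) => bigLam s ((t j : ℝ) * y)), Finset.mul_sum, ← Finset.sum_neg_distrib,
    Real.exp_sum]
  refine Finset.prod_congr rfl fun j _ => ?_
  have hcont : Continuous fun y : ℝ≥0 => bigLam s ((t j : ℝ) * y) :=
    (continuous_bigLam hs).comp (by fun_prop)
  rw [integral_map (by fun_prop) hcont.aestronglyMeasurable]
  have h := integral_bigLam_rayleigh hs (t j * c j)
  simp only [NNReal.coe_mul, ← mul_assoc]
  rw [h]
  congr 1
  ring

/-- A Parseval identity: Fubini, and the symmetry of the kernel in `t` and `x`. -/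
theorem integral_radCF_rayleighProd (hs : -1 / 2 ≤ s) (μ : Measure (Fin k → ℝ≥0))
    [IsFiniteMeasure μ] (c : Fin k → ℝ≥0) :
    ∫ t, radCF s μ t ∂rayleighProd s c =
      ∫ x, Real.exp (-(curv s * ∑ j, (c j : ℝ) ^ 2 * (x j : ℝ) ^ 2)) ∂μ := by
  have := isProbabilityMeasure_rayleighProd hs c
  simp only [radCF_eq]
  rw [integral_integral_swap (Integrable.of_bound
    (continuous_lamProd_uncurry hs).aestronglyMeasurable 1
    (ae_of_all _ fun p => abs_lamProd_le_one hs p.1 p.2))]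
  refine integral_congr_ae (ae_of_all _ fun x => ?_)
  simp only
  rw [← radCF_rayleighProd hs]
  exact integral_congr_ae (ae_of_all _ fun t => lamProd_comm _ _)

/-- The scales `c` for which `κ c_j² = n_j`. -/
noncomputable def laplaceScale (s : ℝ) (n : Fin k → ℕ) (j : Fin k) : ℝ≥0 :=
  NNReal.sqrt (n j / (curv s).toNNReal)

theorem curv_mul_sum_laplaceScale (hs : -1 / 2 ≤ s) (n : Fin k → ℕ) (x : Fin k → ℝ≥0) :
    curv s * ∑ j, (laplaceScale s n j : ℝ) ^ 2 * (x j : ℝ) ^ 2 =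
      ∑ j, (n j : ℝ) * (x j : ℝ) ^ 2 := by
  have hc := curv_pos hs
  rw [Finset.mul_sum]
  refine Finset.sum_congr rfl fun j _ => ?_
  rw [laplaceScale, ← NNReal.coe_pow, NNReal.sq_sqrt, NNReal.coe_div, Real.coe_toNNReal _ hc.le,
    NNReal.coe_natCast]
  field_simp

theorem radCF_laplaceScale (hs : -1 / 2 ≤ s) (n : Fin k → ℕ) (x : Fin k → ℝ≥0) :
    radCF s (rayleighProd s (laplaceScale s n)) x = laplaceFun n x := by
  rw [radCF_rayleighProd hs, curv_mul_sum_laplaceScale hs, laplaceFun_apply]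

/-- Finite measures with the same radial characteristic function are equal. -/
theorem ext_of_radCF (hs : -1 / 2 ≤ s) {μ ν : Measure (Fin k → ℝ≥0)} [IsFiniteMeasure μ]
    [IsFiniteMeasure ν] (h : ∀ t, radCF s μ t = radCF s ν t) : μ = ν := by
  refine ext_of_integral_laplaceFun fun n => ?_
  have h1 := integral_radCF_rayleighProd hs μ (laplaceScale s n)
  have h2 := integral_radCF_rayleighProd hs ν (laplaceScale s n)
  simp only [curv_mul_sum_laplaceScale hs] at h1 h2
  simp only [laplaceFun_apply]
  rw [← h1, ← h2]
  exact integral_congr_ae (ae_of_all _ h)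

/-! ### Measures with a given pair, and Rayleighian laws -/

theorem HasLevyPair.radCF_eq_exp {μ M : Measure (Fin k → ℝ≥0)} {lam : Fin k → ℝ≥0}
    (h : HasLevyPair s μ M lam) (t : Fin k → ℝ≥0) :
    radCF s μ t = Real.exp (-((1 / 2 : ℝ) * ∑ j, (lam j : ℝ) ^ 2 * (t j : ℝ) ^ 2 +
      ∫ x, levyIntegrand s t x ∂M)) := by
  rw [← h.neg_log_radCF, neg_neg, Real.exp_log (h.radCF_pos t)]

/-- A probability measure is determined by its Lévy pair. -/
theorem eq_of_hasLevyPair (hs : -1 / 2 ≤ s) {μ ν M : Measure (Fin k → ℝ≥0)}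
    [IsProbabilityMeasure μ] [IsProbabilityMeasure ν] {lam : Fin k → ℝ≥0}
    (hμ : HasLevyPair s μ M lam) (hν : HasLevyPair s ν M lam) : μ = ν :=
  ext_of_radCF hs fun t => by rw [hμ.radCF_eq_exp, hν.radCF_eq_exp]

/-- The exponent is quadratic in the scales, so the `m`-th root has scales `c_j/√m`. -/
theorem isInfDiv_rayleighProd (hs : -1 / 2 ≤ s) (c : Fin k → ℝ≥0) :
    IsInfDiv s (rayleighProd s c) := by
  intro m hm
  have h1 := isProbabilityMeasure_rayleighProd hs c
  have h2 := isProbabilityMeasure_rayleighProd hs fun j => c j / NNReal.sqrt m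
  refine ⟨_, h2, ?_⟩
  have h3 := isProbabilityMeasure_convPow hs (rayleighProd s fun j => c j / NNReal.sqrt m) m
  refine ext_of_radCF hs fun t => ?_
  rw [radCF_convPow hs, radCF_rayleighProd hs, radCF_rayleighProd hs, ← Real.exp_nat_mul]
  congr 1
  have hm' : (m : ℝ) ≠ 0 := by positivity
  have e : ∀ j, ((c j / NNReal.sqrt m : ℝ≥0) : ℝ) ^ 2 * (t j : ℝ) ^ 2 =
      (c j : ℝ) ^ 2 * (t j : ℝ) ^ 2 / m := fun j => by
    rw [NNReal.coe_div, div_pow, ← NNReal.coe_pow (NNReal.sqrt m), NNReal.sq_sqrt]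
    simp only [NNReal.coe_natCast]
    ring
  simp only [e, ← Finset.sum_div]
  field_simp

theorem isLevyMeasure_zero : IsLevyMeasure (0 : Measure (Fin k → ℝ≥0)) where
  sigmaFinite := inferInstance
  zero := by simp
  finite_compl := by simp
  lintegral_lt_top := by simp

theorem hasLevyPair_zero_iff {μ : Measure (Fin k → ℝ≥0)}
    {lam : Fin k → ℝ≥0} : HasLevyPair s μ 0 lam ↔ ∀ t, radCF s μ t =
      Real.exp (-((1 / 2 : ℝ) * ∑ j, (lam j : ℝ) ^ 2 * (t j : ℝ) ^ 2)) := by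
  refine ⟨fun h t => by simpa using h.radCF_eq_exp t, fun h => ⟨isLevyMeasure_zero,
    fun t => by simp, fun t => by rw [h]; positivity, fun t => by rw [h, Real.log_exp]; simp⟩⟩

theorem half_mul_sum_eq_curv_mul_sum {lam c : Fin k → ℝ≥0}
    (h : ∀ j, (lam j : ℝ) ^ 2 = 2 * curv s * (c j : ℝ) ^ 2) (t : Fin k → ℝ≥0) :
    (1 / 2 : ℝ) * ∑ j, (lam j : ℝ) ^ 2 * (t j : ℝ) ^ 2 =
      curv s * ∑ j, (c j : ℝ) ^ 2 * (t j : ℝ) ^ 2 := by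
  rw [Finset.mul_sum, Finset.mul_sum]
  refine Finset.sum_congr rfl fun j _ => ?_
  rw [h]
  ring

/-- A law is Rayleighian if and only if it is infinitely divisible without Lévy measure. -/
theorem isRayleighian_iff (hs : -1 / 2 ≤ s) (μ : Measure (Fin k → ℝ≥0)) [IsProbabilityMeasure μ] :
    IsRayleighian s μ ↔ IsInfDiv s μ ∧ ∃ lam : Fin k → ℝ≥0, HasLevyPair s μ 0 lam := by
  have hc := curv_pos hs
  constructor
  · rintro ⟨c, hμ⟩
    have hμ : μ = rayleighProd s c := hμ
    subst hμ
    -- Matching `λ_j² t_j²/2` with `κ c_j² t_j²` forces `λ_j² = 2κ c_j²`.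
    refine ⟨isInfDiv_rayleighProd hs c, fun j => NNReal.sqrt (2 * (curv s).toNNReal) * c j,
      (hasLevyPair_zero_iff).2 fun t => ?_⟩
    rw [half_mul_sum_eq_curv_mul_sum (c := c) (fun j => ?_), radCF_rayleighProd hs]
    rw [NNReal.coe_mul, mul_pow, ← NNReal.coe_pow (NNReal.sqrt _), NNReal.sq_sqrt]
    simp [hc.le]
  · rintro ⟨-, lam, h⟩
    refine ⟨fun j => lam j / NNReal.sqrt (2 * (curv s).toNNReal), ?_⟩
    change μ = rayleighProd s _
    have := isProbabilityMeasure_rayleighProd hs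
      fun j => lam j / NNReal.sqrt (2 * (curv s).toNNReal)
    refine ext_of_radCF hs fun t => ?_
    rw [(hasLevyPair_zero_iff).1 h, radCF_rayleighProd hs,
      half_mul_sum_eq_curv_mul_sum fun j => ?_]
    rw [NNReal.coe_div, div_pow, ← NNReal.coe_pow (NNReal.sqrt _), NNReal.sq_sqrt]
    simp [hc.le]
    field_simp

/-! ### Bounds on the Lévy–Khinchin integrand and finiteness of the Lévy measure -/

theorem continuous_normSq : Continuous (normSq : (Fin k → ℝ≥0) → ℝ) := by
  unfold normSq
  fun_prop

theorem normSq_nonneg (x : Fin k → ℝ≥0) : 0 ≤ normSq x :=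
  Finset.sum_nonneg fun j _ => by positivity

theorem sq_le_normSq (x : Fin k → ℝ≥0) (j : Fin k) : (x j : ℝ) ^ 2 ≤ normSq x :=
  Finset.single_le_sum (f := fun j => (x j : ℝ) ^ 2) (fun j _ => by positivity) (Finset.mem_univ j)

theorem normSq_pos {x : Fin k → ℝ≥0} (hx : x ≠ 0) : 0 < normSq x := by
  obtain ⟨j, hj⟩ := Function.ne_iff.1 hx
  have hj' : x j ≠ 0 := hj
  have : (0 : ℝ) < (x j : ℝ) ^ 2 := by positivity
  exact this.trans_le (sq_le_normSq x j)

theorem normSq_zero : normSq (0 : Fin k → ℝ≥0) = 0 := by simp [normSq]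

theorem levyIntegrand_eq (t x : Fin k → ℝ≥0) :
    levyIntegrand s t x = (1 - lamProd s t x) * ((1 + normSq x) / normSq x) := rfl

theorem measurable_levyIntegrand_uncurry (hs : -1 / 2 ≤ s) :
    Measurable fun p : (Fin k → ℝ≥0) × (Fin k → ℝ≥0) => levyIntegrand s p.1 p.2 := by
  simp only [levyIntegrand_eq]
  have h := (continuous_lamProd_uncurry (k := k) hs).measurable
  have h2 := (continuous_normSq (k := k)).measurable
  fun_prop

theorem levyIntegrand_nonneg (hs : -1 / 2 ≤ s) (t x : Fin k → ℝ≥0) : 0 ≤ levyIntegrand s t x := by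
  have h := normSq_nonneg x
  exact mul_nonneg (sub_nonneg.2 (lamProd_le_one hs t x)) (by positivity)

/-- A telescoping sum in which the `j`-th term keeps a factor `1 - Λ_s(t_j x_j)`, of second order in
`x_j`. -/
theorem one_sub_lamProd (t x : Fin k → ℝ≥0) :
    1 - lamProd s t x = ∑ j, (1 - bigLam s (t j * x j)) *
      ∏ i with i < j, bigLam s ((t i : ℝ) * x i) := by
  have h := Finset.prod_one_sub_ordered Finset.univ
    fun j : Fin k => 1 - bigLam s ((t j : ℝ) * x j)
  simp only [sub_sub_cancel] at h
  rw [lamProd, h, sub_sub_cancel]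

theorem one_sub_lamProd_le_sum (hs : -1 / 2 ≤ s) (t x : Fin k → ℝ≥0) :
    1 - lamProd s t x ≤ ∑ j, (1 - bigLam s (t j * x j)) := by
  rw [one_sub_lamProd]
  refine Finset.sum_le_sum fun j _ => mul_le_of_le_one_right (one_sub_bigLam_nonneg hs _) ?_
  refine (le_abs_self _).trans ?_
  rw [Finset.abs_prod]
  exact Finset.prod_le_one (fun _ _ => abs_nonneg _) fun _ _ => abs_bigLam_le_one hs _

/-- As `(1+r)/r = 1 + 1/r` with `r = ‖x‖²`, the bound `2` on `1 - ∏ Λ_s` handles the first term and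
the quadratic bound the second. At `x = 0` division by zero makes the integrand `0`. -/
theorem levyIntegrand_le (hs : -1 / 2 ≤ s) (t x : Fin k → ℝ≥0) :
    levyIntegrand s t x ≤ 2 + normSq t / 2 := by
  have ht := normSq_nonneg t
  rcases eq_or_ne x 0 with rfl | hx
  · rw [levyIntegrand_eq, normSq_zero, div_zero, mul_zero]
    positivity
  have hx := normSq_pos hx
  have h1 : 1 - lamProd s t x ≤ 2 := by linarith [(abs_le.1 (abs_lamProd_le_one hs t x)).1]
  have h2 : 1 - lamProd s t x ≤ normSq t / 2 * normSq x := by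
    refine (one_sub_lamProd_le_sum hs t x).trans ?_
    rw [normSq, normSq, Finset.mul_sum]
    refine Finset.sum_le_sum fun j _ => (one_sub_bigLam_le_sq hs _).trans ?_
    have := sq_le_normSq t j
    rw [normSq] at this
    rw [mul_pow]
    nlinarith [sq_nonneg (x j : ℝ)]
  rw [levyIntegrand_eq, add_div, mul_add, div_self hx.ne', mul_one, mul_one_div, add_comm]
  exact add_le_add h1 ((div_le_iff₀ hx).2 h2)

theorem levyIntegrand_single (hs : -1 / 2 ≤ s) (j : Fin k) (x : Fin k → ℝ≥0) :
    levyIntegrand s (Pi.single j 1) x =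
      (x j : ℝ) ^ 2 * lamQuot s (x j) * ((1 + normSq x) / normSq x) := by
  rw [levyIntegrand_eq, lamProd_single hs, NNReal.coe_one, one_mul, one_sub_bigLam hs]

/-- Convergence of the Lévy–Khinchin integrals forces the measure `M` to be finite. -/
theorem HasLevyPair.isFiniteMeasure (hs : -1 / 2 ≤ s) {μ M : Measure (Fin k → ℝ≥0)}
    {lam : Fin k → ℝ≥0} (h : HasLevyPair s μ M lam) : IsFiniteMeasure M := by
  have hc := curv_pos hs
  have h1 : ∀ᶠ z in 𝓝 (0 : ℝ), curv s / 2 < lamQuot s z :=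
    (continuous_lamQuot hs).continuousAt.eventually (lt_mem_nhds (by rw [lamQuot_zero]; linarith))
  have h2 : ∀ᶠ x in 𝓝 (0 : Fin k → ℝ≥0), ∀ j, curv s / 2 < lamQuot s (x j) := by
    refine eventually_all.2 fun j => ?_
    have hcont : Continuous fun x : Fin k → ℝ≥0 => (x j : ℝ) := by fun_prop
    have := hcont.tendsto 0
    simp only [Pi.zero_apply, NNReal.coe_zero] at this
    exact this.eventually h1
  set U := {x : Fin k → ℝ≥0 | ∀ j, curv s / 2 < lamQuot s (x j)}
  have hU : M Uᶜ < ∞ := h.isLevyMeasure.finite_compl U h2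
  have hint : Integrable (fun x => ∑ j, levyIntegrand s (Pi.single j 1) x) M :=
    integrable_finsetSum _ fun j _ => h.integrable _
  have hV := hint.measure_norm_ge_lt_top (half_pos hc)
  -- Near `0` the sum of the integrands at the unit vectors exceeds `κ/2`. So the space is covered
  -- by a superlevel set of an integrable function, the complement of a neighbourhood of `0`, and
  -- the null set `{0}`.
  have hsub : univ ⊆ {x | curv s / 2 ≤ ‖∑ j, levyIntegrand s (Pi.single j 1) x‖} ∪
      (Uᶜ ∪ {0}) := by
    intro x _
    by_cases hx0 : x = 0
    · exact Or.inr (Or.inr hx0)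
    by_cases hxU : x ∈ U
    · refine Or.inl ?_
      have hx := normSq_pos hx0
      simp only [mem_ofPred_eq]
      refine le_trans ?_ (le_abs_self _)
      simp only [levyIntegrand_single hs]
      rw [← Finset.sum_mul]
      calc curv s / 2 ≤ curv s / 2 * (1 + normSq x) := by nlinarith
        _ = (∑ j, (x j : ℝ) ^ 2 * (curv s / 2)) * ((1 + normSq x) / normSq x) := by
          rw [← Finset.sum_mul, ← normSq]
          field_simp
        _ ≤ _ := by
          gcongr with j
          exact (hxU j).le
    · exact Or.inr (Or.inl hxU)
  refine ⟨(measure_mono hsub).trans_lt ?_⟩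
  refine (measure_union_le _ _).trans_lt (ENNReal.add_lt_top.2 ⟨hV, ?_⟩)
  refine (measure_union_le _ _).trans_lt (ENNReal.add_lt_top.2 ⟨hU, ?_⟩)
  rw [h.isLevyMeasure.zero]
  simp

/-! ### Uniqueness of the pair through Bernstein functions -/

theorem integrable_sq_rayleighProd (hs : -1 / 2 ≤ s) (c : Fin k → ℝ≥0) (j : Fin k) :
    Integrable (fun t : Fin k → ℝ≥0 => (t j : ℝ) ^ 2) (rayleighProd s c) ∧
      ∫ t, (t j : ℝ) ^ 2 ∂rayleighProd s c = (c j : ℝ) ^ 2 := by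
  have := fun j => isProbabilityMeasure_map_rayleigh hs (c j)
  have hp := measurePreserving_eval (fun j => (rayleigh s).map fun y => c j * y) j
  have hcont : Continuous fun y : ℝ≥0 => (y : ℝ) ^ 2 := by fun_prop
  have hm : Measurable fun y => c j * y := by fun_prop
  have e : ∀ y : ℝ≥0, ((c j * y : ℝ≥0) : ℝ) ^ 2 = (c j : ℝ) ^ 2 * (y : ℝ) ^ 2 := fun y => by
    rw [NNReal.coe_mul, mul_pow]
  have h1 : Integrable (fun y : ℝ≥0 => (y : ℝ) ^ 2) ((rayleigh s).map fun y => c j * y) := by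
    rw [integrable_map_measure hcont.aestronglyMeasurable hm.aemeasurable]
    simp only [Function.comp_def, e]
    simpa using (integrable_pow_rayleigh hs 1).const_mul ((c j : ℝ) ^ 2)
  refine ⟨hp.integrable_comp_of_integrable h1, ?_⟩
  have h2 : ∫ t, (t j : ℝ) ^ 2 ∂rayleighProd s c =
      ∫ y : ℝ≥0, (y : ℝ) ^ 2 ∂((rayleigh s).map fun y => c j * y) := by
    rw [← hp.map_eq, integral_map (measurable_pi_apply j).aemeasurable hcont.aestronglyMeasurable]
    rfl
  rw [h2, integral_map hm.aemeasurable hcont.aestronglyMeasurable]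
  simp only [e]
  rw [integral_const_mul, integral_sq_rayleigh hs, mul_one]

theorem integrable_normSq_rayleighProd (hs : -1 / 2 ≤ s) (c : Fin k → ℝ≥0) :
    Integrable (normSq : (Fin k → ℝ≥0) → ℝ) (rayleighProd s c) :=
  integrable_finsetSum _ fun j _ => (integrable_sq_rayleighProd hs c j).1

/-- Averaging the exponent of a Lévy pair over Rayleigh laws gives a Bernstein function. -/
theorem HasLevyPair.integral_neg_log_radCF (hs : -1 / 2 ≤ s) {μ M : Measure (Fin k → ℝ≥0)}
    {lam : Fin k → ℝ≥0} (h : HasLevyPair s μ M lam) (n : Fin k → ℕ) :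
    ∫ t, -Real.log (radCF s μ t) ∂rayleighProd s (laplaceScale s n) =
      ∑ j, (lam j : ℝ) ^ 2 / (2 * curv s) * n j +
        ∫ x, (1 - laplaceFun n x) * ((1 + normSq x) / normSq x) ∂M := by
  have := h.isFiniteMeasure hs
  have hP := isProbabilityMeasure_rayleighProd hs (laplaceScale s n)
  have hc := curv_pos hs
  -- Fubini applies because the integrand is at most `2 + ‖t‖²/2`, and Rayleigh laws have finite
  -- second moments.
  have hint : Integrable (fun p : (Fin k → ℝ≥0) × (Fin k → ℝ≥0) => levyIntegrand s p.1 p.2)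
      ((rayleighProd s (laplaceScale s n)).prod M) := by
    have hb : Integrable (fun p : (Fin k → ℝ≥0) × (Fin k → ℝ≥0) => 2 + normSq p.1 / 2)
        ((rayleighProd s (laplaceScale s n)).prod M) :=
      (integrable_const _).add
        (((integrable_normSq_rayleighProd hs _).comp_fst M).div_const 2)
    refine hb.mono' (measurable_levyIntegrand_uncurry hs).aestronglyMeasurable
      (ae_of_all _ fun p => ?_)
    rw [Real.norm_of_nonneg (levyIntegrand_nonneg hs _ _)]
    exact levyIntegrand_le hs _ _
  simp only [h.neg_log_radCF]
  rw [integral_add]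
  · congr 1
    · rw [integral_const_mul, integral_finsetSum _
        fun j _ => (integrable_sq_rayleighProd hs _ j).1.const_mul _, Finset.mul_sum]
      refine Finset.sum_congr rfl fun j _ => ?_
      rw [integral_const_mul, (integrable_sq_rayleighProd hs _ j).2, laplaceScale,
        ← NNReal.coe_pow (NNReal.sqrt _), NNReal.sq_sqrt, NNReal.coe_div,
        Real.coe_toNNReal _ hc.le, NNReal.coe_natCast]
      field_simp
    · rw [integral_integral_swap hint]
      refine integral_congr_ae (ae_of_all _ fun x => ?_)
      simp only [levyIntegrand_eq]
      rw [integral_mul_const, integral_sub (integrable_const _)]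
      · simp only [integral_const, probReal_univ, smul_eq_mul, mul_one]
        rw [← radCF_laplaceScale hs]
        simp only [lamProd_comm _ x]
        rfl
      · simp only [lamProd_comm _ x]
        exact integrable_lamProd hs _ x
  · exact (integrable_finsetSum _
      fun j _ => (integrable_sq_rayleighProd hs _ j).1.const_mul _).const_mul _
  · exact hint.integral_prod_left

theorem mul_one_add_normSq_div_le {a b g : ℝ} (x : Fin k → ℝ≥0) (ha : 0 ≤ a) (hb : 0 ≤ b)
    (h1 : g ≤ a) (h2 : g ≤ b * normSq x) : g * ((1 + normSq x) / normSq x) ≤ a + b := by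
  rcases eq_or_ne x 0 with rfl | hx
  · rw [normSq_zero, div_zero, mul_zero]
    positivity
  have hx := normSq_pos hx
  rw [add_div, mul_add, div_self hx.ne', mul_one, mul_one_div, add_comm]
  exact add_le_add h1 ((div_le_iff₀ hx).2 h2)

theorem laplaceFun_le_one (n : Fin k → ℕ) (x : Fin k → ℝ≥0) : laplaceFun n x ≤ 1 := by
  rw [laplaceFun_apply, Real.exp_le_one_iff, neg_nonpos]
  exact Finset.sum_nonneg fun j _ => by positivity

theorem laplaceFun_single (j : Fin k) (x : Fin k → ℝ≥0) :
    laplaceFun (Pi.single j 1) x = Real.exp (-(x j : ℝ) ^ 2) := by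
  rw [laplaceFun_apply, Finset.sum_eq_single j (fun i _ hi => by simp [hi]) (by simp)]
  simp

theorem one_sub_laplaceFun_mul_nonneg (n : Fin k → ℕ) (x : Fin k → ℝ≥0) :
    0 ≤ (1 - laplaceFun n x) * ((1 + normSq x) / normSq x) := by
  have := normSq_nonneg x
  have := sub_nonneg.2 (laplaceFun_le_one n x)
  positivity

theorem one_sub_laplaceFun_mul_le (n : Fin k → ℕ) (x : Fin k → ℝ≥0) :
    (1 - laplaceFun n x) * ((1 + normSq x) / normSq x) ≤ 1 + ∑ j, (n j : ℝ) := by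
  refine mul_one_add_normSq_div_le x zero_le_one (Finset.sum_nonneg fun j _ => by positivity) ?_ ?_
  · rw [laplaceFun_apply]
    linarith [Real.exp_pos (-∑ j, (n j : ℝ) * (x j : ℝ) ^ 2)]
  · have h := Real.add_one_le_exp (-∑ j, (n j : ℝ) * (x j : ℝ) ^ 2)
    have h2 : ∑ j, (n j : ℝ) * (x j : ℝ) ^ 2 ≤ (∑ j, (n j : ℝ)) * normSq x := by
      rw [Finset.sum_mul]
      gcongr with j
      exact sq_le_normSq x j
    rw [laplaceFun_apply]
    linarith

theorem measurable_one_sub_laplaceFun_mul (n : Fin k → ℕ) :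
    Measurable fun x => (1 - laplaceFun n x) * ((1 + normSq x) / normSq x) := by
  have h := (laplaceFun n).continuous.measurable
  have h2 := (continuous_normSq (k := k)).measurable
  fun_prop

theorem integrable_one_sub_laplaceFun_mul (M : Measure (Fin k → ℝ≥0)) [IsFiniteMeasure M]
    (n : Fin k → ℕ) :
    Integrable (fun x => (1 - laplaceFun n x) * ((1 + normSq x) / normSq x)) M := by
  refine Integrable.of_bound (measurable_one_sub_laplaceFun_mul n).aestronglyMeasurable
    (1 + ∑ j, (n j : ℝ)) (ae_of_all _ fun x => ?_)
  rw [Real.norm_of_nonneg (one_sub_laplaceFun_mul_nonneg n x)]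
  exact one_sub_laplaceFun_mul_le n x

/-- The density, with respect to the Lévy measure, of the `j`-th difference measure. -/
noncomputable def diffDensity (j : Fin k) (x : Fin k → ℝ≥0) : ℝ≥0∞ :=
  ENNReal.ofReal ((1 - laplaceFun (Pi.single j 1) x) * ((1 + normSq x) / normSq x))

theorem measurable_diffDensity (j : Fin k) : Measurable (diffDensity j) :=
  (measurable_one_sub_laplaceFun_mul _).ennreal_ofReal

/-- The finite measure whose Laplace transform is the `j`-th difference of the Bernstein function
of a Lévy pair. -/
noncomputable def diffMeasure (s : ℝ) (M : Measure (Fin k → ℝ≥0)) (lam : Fin k → ℝ≥0) (j : Fin k) :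
    Measure (Fin k → ℝ≥0) :=
  ENNReal.ofReal ((lam j : ℝ) ^ 2 / (2 * curv s)) • Measure.dirac 0 + M.withDensity (diffDensity j)

instance isFiniteMeasure_withDensity_diffDensity (M : Measure (Fin k → ℝ≥0)) [IsFiniteMeasure M]
    (j : Fin k) : IsFiniteMeasure (M.withDensity (diffDensity j)) :=
  isFiniteMeasure_withDensity_ofReal (integrable_one_sub_laplaceFun_mul M _).2

instance isFiniteMeasure_diffMeasure (M : Measure (Fin k → ℝ≥0)) [IsFiniteMeasure M]
    (lam : Fin k → ℝ≥0) (j : Fin k) : IsFiniteMeasure (diffMeasure s M lam j) := by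
  have : IsFiniteMeasure (ENNReal.ofReal ((lam j : ℝ) ^ 2 / (2 * curv s)) •
    Measure.dirac (0 : Fin k → ℝ≥0)) := Measure.smul_finite _ ENNReal.ofReal_ne_top
  unfold diffMeasure
  infer_instance

/-- Differencing turns `1 - exp(-∑ n_i x_i²)` into `exp(-∑ n_i x_i²) (1 - exp(-x_j²))`, and the
linear term into a constant, which is the transform of an atom at `0`. The right side involves only
`μ`, so `diffMeasure` is determined by `μ`. -/
theorem HasLevyPair.integral_laplaceFun_diffMeasure (hs : -1 / 2 ≤ s)
    {μ M : Measure (Fin k → ℝ≥0)} {lam : Fin k → ℝ≥0} (h : HasLevyPair s μ M lam) (j : Fin k)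
    (n : Fin k → ℕ) :
    ∫ x, laplaceFun n x ∂diffMeasure s M lam j =
      ∫ t, -Real.log (radCF s μ t) ∂rayleighProd s (laplaceScale s (n + Pi.single j 1)) -
        ∫ t, -Real.log (radCF s μ t) ∂rayleighProd s (laplaceScale s n) := by
  have := h.isFiniteMeasure hs
  have hc := curv_pos hs
  have hfin := isFiniteMeasure_diffMeasure (s := s) M lam j
  have hint := (laplaceFun n).integrable (diffMeasure s M lam j)
  rw [h.integral_neg_log_radCF hs, h.integral_neg_log_radCF hs]
  unfold diffMeasure at hint ⊢
  rw [integral_add_measure hint.left_of_add_measure hint.right_of_add_measure,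
    integral_smul_measure, integral_dirac, ENNReal.toReal_ofReal (by positivity),
    integral_withDensity_eq_integral_toReal_smul (measurable_diffDensity j)
      (ae_of_all _ fun _ => ENNReal.ofReal_lt_top), add_sub_add_comm,
    ← Finset.sum_sub_distrib, ← integral_sub (integrable_one_sub_laplaceFun_mul M _)
      (integrable_one_sub_laplaceFun_mul M _)]
  congr 1
  · rw [Finset.sum_eq_single j (fun i _ hi => by simp [hi]) (by simp)]
    simp only [Pi.add_apply, Pi.single_eq_same, smul_eq_mul]
    rw [laplaceFun_apply]
    simp
    ring
  · refine integral_congr_ae (ae_of_all _ fun x => ?_)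
    simp only [smul_eq_mul, diffDensity]
    rw [ENNReal.toReal_ofReal (one_sub_laplaceFun_mul_nonneg _ _), laplaceFun_add,
      BoundedContinuousFunction.mul_apply]
    ring

theorem withDensity_diffDensity_singleton {M : Measure (Fin k → ℝ≥0)} (h : M {0} = 0) (j : Fin k) :
    M.withDensity (diffDensity j) {0} = 0 :=
  withDensity_absolutelyContinuous _ _ h

theorem sum_diffDensity_ne_zero {x : Fin k → ℝ≥0} (hx : x ≠ 0) : ∑ j, diffDensity j x ≠ 0 := by
  obtain ⟨j, hj⟩ := Function.ne_iff.1 hx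
  have hn := normSq_pos hx
  have hj' : (0 : ℝ) < (x j : ℝ) ^ 2 := by
    have : x j ≠ 0 := hj
    positivity
  intro h
  have h2 := (Finset.sum_eq_zero_iff.1 h) j (Finset.mem_univ j)
  rw [diffDensity, ENNReal.ofReal_eq_zero, laplaceFun_single] at h2
  have h3 : Real.exp (-(x j : ℝ) ^ 2) < 1 := by
    rw [← Real.exp_zero]
    exact Real.exp_lt_exp.2 (by linarith)
  have : 0 < (1 - Real.exp (-(x j : ℝ) ^ 2)) * ((1 + normSq x) / normSq x) :=
    mul_pos (by linarith) (by positivity)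
  linarith

/-- A probability measure has at most one Lévy pair. -/
theorem HasLevyPair.unique (hs : -1 / 2 ≤ s) {μ M M' : Measure (Fin k → ℝ≥0)}
    {lam lam' : Fin k → ℝ≥0} (h : HasLevyPair s μ M lam) (h' : HasLevyPair s μ M' lam') :
    M = M' ∧ lam = lam' := by
  have := h.isFiniteMeasure hs
  have := h'.isFiniteMeasure hs
  have hc := curv_pos hs
  have hU : ∀ j, diffMeasure s M lam j = diffMeasure s M' lam' j := fun j =>
    ext_of_integral_laplaceFun fun n => by
      rw [h.integral_laplaceFun_diffMeasure hs, h'.integral_laplaceFun_diffMeasure hs]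
  -- `M` does not charge `0`, so the mass at `0` is the Gaussian coefficient alone.
  have hlam : lam = lam' := by
    funext j
    have h1 := congrArg (fun ν : Measure (Fin k → ℝ≥0) => ν {0}) (hU j)
    simp only [diffMeasure, Measure.add_apply, Measure.smul_apply,
      withDensity_diffDensity_singleton h.isLevyMeasure.zero,
      withDensity_diffDensity_singleton h'.isLevyMeasure.zero, add_zero, smul_eq_mul,
      Measure.dirac_apply_of_mem (mem_singleton _), mul_one] at h1
    rw [ENNReal.ofReal_eq_ofReal_iff (by positivity) (by positivity), div_left_inj' (by positivity),
      sq_eq_sq₀ (by positivity) (by positivity)] at h1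
    exact_mod_cast h1
  refine ⟨?_, hlam⟩
  subst hlam
  have hW : ∀ j, M.withDensity (diffDensity j) = M'.withDensity (diffDensity j) := fun j => by
    ext A hA
    have h1 := congrArg (fun ν : Measure (Fin k → ℝ≥0) => ν A) (hU j)
    simp only [diffMeasure, Measure.add_apply] at h1
    refine (ENNReal.add_right_inj ?_).1 h1
    rw [Measure.smul_apply, smul_eq_mul]
    exact ENNReal.mul_ne_top ENNReal.ofReal_ne_top (measure_ne_top _ _)
  -- A single density vanishes where `x_j = 0`; the sum over `j` is positive off `0` and finite, so
  -- it can be divided out.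
  have hD : M.withDensity (fun x => ∑ j, diffDensity j x) =
      M'.withDensity (fun x => ∑ j, diffDensity j x) := by
    ext A hA
    rw [withDensity_apply _ hA, withDensity_apply _ hA,
      lintegral_finsetSum _ fun j _ => measurable_diffDensity j,
      lintegral_finsetSum _ fun j _ => measurable_diffDensity j]
    refine Finset.sum_congr rfl fun j _ => ?_
    rw [← withDensity_apply _ hA, ← withDensity_apply _ hA, hW]
  have hmeas : Measurable fun x : Fin k → ℝ≥0 => ∑ j, diffDensity j x :=
    Finset.measurable_sum _ fun j _ => measurable_diffDensity j
  have hinv : ∀ N : Measure (Fin k → ℝ≥0), N {0} = 0 →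
      (N.withDensity fun x => ∑ j, diffDensity j x).withDensity
        (fun x => (∑ j, diffDensity j x)⁻¹) = N := fun N hN => by
    refine withDensity_inv_same hmeas ?_ ?_
    · have : ∀ᵐ x ∂N, x ∉ ({0} : Set (Fin k → ℝ≥0)) := measure_eq_zero_iff_ae_notMem.1 hN
      filter_upwards [this] with x hx
      exact sum_diffDensity_ne_zero hx
    · exact ae_of_all _ fun x => (ENNReal.sum_lt_top.2 fun j _ => ENNReal.ofReal_lt_top).ne
  rw [← hinv M h.isLevyMeasure.zero, hD, hinv M' h'.isLevyMeasure.zero]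

/-! ### Roots: positivity and the limit of `N(1 - q^(1/N))` -/

theorem tendsto_inv_natCast_add_one :
    Tendsto (fun n : ℕ => ((n : ℝ≥0) + 1)⁻¹) atTop (𝓝 0) := by
  rw [← NNReal.tendsto_coe]
  simpa using tendsto_one_div_add_atTop_nhds_zero_nat (𝕜 := ℝ)

/-- If the `n`-th power of `y ≤ 1` is `q > 0` with `n` odd, then `y` is close to `1`. -/
theorem mul_one_sub_le_neg_log {n : ℕ} (hn : Odd n) {y q : ℝ} (hy : y ^ n = q) (hq : 0 < q) :
    0 < y ∧ n * (1 - y) ≤ -Real.log q := by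
  have hy0 : 0 < y := hn.pow_pos_iff.1 (hy ▸ hq)
  refine ⟨hy0, ?_⟩
  rw [← hy, Real.log_pow, ← mul_neg]
  gcongr
  linarith [Real.log_le_sub_one_of_pos hy0]

/-- At `t' = t/(n+1)`, close to `0`, the transform is some `q > 0`, so its root of order `N = 2m+1`
is within `-log q / N` of `1`. Dilation by `n+1` costs only the factor `(n+1)²`, so for large `N`
the root at `t` is positive too, and hence its power. -/
theorem radCF_pos_of_roots (hs : -1 / 2 ≤ s) {μ : Measure (Fin k → ℝ≥0)} [IsProbabilityMeasure μ]
    {ν : ℕ → Measure (Fin k → ℝ≥0)} [∀ m, IsProbabilityMeasure (ν m)]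
    (h : ∀ m t, radCF s (ν m) t ^ (2 * m + 1) = radCF s μ t) (t : Fin k → ℝ≥0) :
    0 < radCF s μ t := by
  have h1 : Tendsto (fun n : ℕ => ((n : ℝ≥0) + 1)⁻¹ • t) atTop (𝓝 0) := by
    have h2 : Tendsto (fun n : ℕ => ((n : ℝ≥0) + 1)⁻¹) atTop (𝓝 0) :=
      tendsto_inv_natCast_add_one
    simpa using h2.smul_const t
  have h3 := ((continuous_radCF hs μ).tendsto 0).comp h1
  rw [radCF_zero hs] at h3
  obtain ⟨n, hn⟩ := (h3.eventually (lt_mem_nhds zero_lt_one)).exists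
  simp only [Function.comp_apply] at hn
  set t' := ((n : ℝ≥0) + 1)⁻¹ • t with ht'
  have htt : t = (n + 1) • t' := by
    rw [ht', ← Nat.cast_smul_eq_nsmul ℝ≥0, smul_smul]
    push_cast
    rw [mul_inv_cancel₀ (by positivity), one_smul]
  set q := radCF s μ t' with hq
  obtain ⟨m, hm⟩ := exists_nat_gt (((n + 1 : ℕ) : ℝ) ^ 2 * -Real.log q)
  have h4 := (mul_one_sub_le_neg_log ⟨m, rfl⟩ (h m t') hn).2
  have h5 := one_sub_radCF_nsmul_le hs (ν m) (n + 1) t'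
  rw [← htt] at h5
  have h6 : 0 < radCF s (ν m) t := by
    have hM : (0 : ℝ) < ((2 * m + 1 : ℕ) : ℝ) := by positivity
    have h7 : ((2 * m + 1 : ℕ) : ℝ) * (1 - radCF s (ν m) t) ≤
        ((n + 1 : ℕ) : ℝ) ^ 2 * -Real.log q := by
      calc ((2 * m + 1 : ℕ) : ℝ) * (1 - radCF s (ν m) t)
          ≤ ((2 * m + 1 : ℕ) : ℝ) * (((n + 1 : ℕ) : ℝ) ^ 2 * (1 - radCF s (ν m) t')) := by gcongr
        _ = ((n + 1 : ℕ) : ℝ) ^ 2 * (((2 * m + 1 : ℕ) : ℝ) * (1 - radCF s (ν m) t')) := by ring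
        _ ≤ _ := by gcongr
    have h8 : (m : ℝ) ≤ ((2 * m + 1 : ℕ) : ℝ) := by exact_mod_cast (by omega)
    have h9 : ((2 * m + 1 : ℕ) : ℝ) * (1 - radCF s (ν m) t) < ((2 * m + 1 : ℕ) : ℝ) * 1 := by
      linarith
    linarith [lt_of_mul_lt_mul_left h9 hM.le]
  rw [← h m t]
  positivity

/-- With `ψ = -log q` and `N = 2m+1`, the term lies between `ψ/(1+ψ/N)` and `ψ`; the lower bound is
`(1+z) exp(-z) ≤ 1` at `z = ψ/N`. -/
theorem tendsto_mul_one_sub_of_pow_eq {y : ℕ → ℝ} {q : ℝ} (hq : 0 < q) (hq1 : q ≤ 1)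
    (h : ∀ m, y m ^ (2 * m + 1) = q) :
    Tendsto (fun m : ℕ => ((2 * m + 1 : ℕ) : ℝ) * (1 - y m)) atTop (𝓝 (-Real.log q)) := by
  set ψ := -Real.log q with hψ
  have hψ0 : 0 ≤ ψ := neg_nonneg.2 (Real.log_nonpos hq.le hq1)
  have hinv : Tendsto (fun m : ℕ => ((2 * m + 1 : ℕ) : ℝ)⁻¹) atTop (𝓝 0) := by
    refine tendsto_inv_atTop_zero.comp (tendsto_natCast_atTop_atTop.comp ?_)
    exact tendsto_atTop_mono (fun m => by simp only [id]; omega) tendsto_id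
  have hlow : Tendsto (fun m : ℕ => ψ / (1 + ψ * ((2 * m + 1 : ℕ) : ℝ)⁻¹)) atTop (𝓝 ψ) := by
    have h1 := (tendsto_const_nhds (x := ψ)).div
      ((tendsto_const_nhds (x := (1 : ℝ))).add (hinv.const_mul ψ)) (by simp)
    simpa [Pi.div_def] using h1
  refine tendsto_of_tendsto_of_tendsto_of_le_of_le hlow tendsto_const_nhds (fun m => ?_)
    fun m => (mul_one_sub_le_neg_log ⟨m, rfl⟩ (h m) hq).2
  have hy0 := (mul_one_sub_le_neg_log ⟨m, rfl⟩ (h m) hq).1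
  set N : ℝ := ((2 * m + 1 : ℕ) : ℝ) with hN
  have hN0 : 0 < N := by positivity
  have h2 : ψ = N * -Real.log (y m) := by
    rw [hψ, ← h m, Real.log_pow]
    ring
  set z := -Real.log (y m) with hz
  have hz0 : 0 ≤ z := nonneg_of_mul_nonneg_right (h2 ▸ hψ0) hN0
  have h3 : y m = Real.exp (-z) := by rw [hz, neg_neg, Real.exp_log hy0]
  have h4 : (1 + z) * y m ≤ 1 := by
    rw [h3]
    calc (1 + z) * Real.exp (-z) ≤ Real.exp z * Real.exp (-z) := by
          gcongr
          linarith [Real.add_one_le_exp z]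
      _ = 1 := by rw [← Real.exp_add]; simp
  have h5 : 1 + ψ * N⁻¹ = 1 + z := by
    rw [h2]
    field_simp
  simp only
  rw [h5, h2, div_le_iff₀ (by positivity)]
  have : z ≤ (1 - y m) * (1 + z) := by linarith
  nlinarith

/-! ### Tightness estimates and compactness -/

/-- Control of a measure by its radial characteristic function near `0`. -/
theorem mul_integral_one_sub_exp_le (hs : -1 / 2 ≤ s) {ν : Measure (Fin k → ℝ≥0)}
    [IsProbabilityMeasure ν] {a ε : ℝ} {δ : ℝ≥0} (ha : 0 ≤ a) (hε : 0 ≤ ε) (hδ : 0 < δ)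
    (h : ∀ t, normSq t ≤ (δ : ℝ) ^ 2 → a * (1 - radCF s ν t) ≤ ε) :
    a * ∫ x, (1 - Real.exp (-(curv s * (δ : ℝ) ^ 2 * normSq x))) ∂ν ≤ (2 * k + 2) * ε := by
  have hP := isProbabilityMeasure_rayleighProd (k := k) hs fun _ => δ
  have hδ' : (0 : ℝ) < δ := hδ
  -- Dividing `t` by `n = ⌈‖t‖/δ⌉` brings it into the ball of radius `δ`; dilating back costs `n² ≤
  -- 2‖t‖²/δ² + 2`.
  have hbound : ∀ t, a * (1 - radCF s ν t) ≤ ε * (2 * (normSq t / (δ : ℝ) ^ 2) + 2) := by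
    intro t
    set n := ⌈√(normSq t) / δ⌉₊ with hn
    rcases Nat.eq_zero_or_pos n with h0 | h0
    · have h1 : √(normSq t) / δ ≤ 0 := by
        have := Nat.le_ceil (√(normSq t) / (δ : ℝ))
        rw [← hn, h0] at this
        simpa using this
      have h2 : normSq t ≤ (δ : ℝ) ^ 2 := by
        rw [div_le_iff₀ hδ', zero_mul] at h1
        rw [Real.sqrt_eq_zero'.1 (le_antisymm h1 (Real.sqrt_nonneg _)) |>.antisymm
          (normSq_nonneg t)]
        positivity
      have h3 : 0 ≤ normSq t / (δ : ℝ) ^ 2 := div_nonneg (normSq_nonneg t) (by positivity)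
      have := h t h2
      nlinarith
    · have hn0 : (0 : ℝ) < n := by exact_mod_cast h0
      set t' := (n : ℝ≥0)⁻¹ • t with ht'
      have htt : t = n • t' := by
        rw [ht', ← Nat.cast_smul_eq_nsmul ℝ≥0, smul_smul, mul_inv_cancel₀ (by positivity), one_smul]
      have h1 : √(normSq t) ≤ n * δ := (div_le_iff₀ hδ').1 (Nat.le_ceil _)
      have h2 : normSq t' ≤ (δ : ℝ) ^ 2 := by
        have e : normSq t' = normSq t / n ^ 2 := by
          rw [normSq, normSq, Finset.sum_div]
          refine Finset.sum_congr rfl fun j _ => ?_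
          rw [ht']
          simp
          field_simp
        rw [e, div_le_iff₀ (by positivity), ← mul_pow, mul_comm (δ : ℝ)]
        exact (Real.sqrt_le_left (by positivity)).1 h1
      have h3 : (n : ℝ) ^ 2 ≤ 2 * (normSq t / (δ : ℝ) ^ 2) + 2 := by
        have h4 := (Nat.ceil_lt_add_one (show 0 ≤ √(normSq t) / (δ : ℝ) by positivity)).le
        rw [← hn] at h4
        have h5 : (√(normSq t) / (δ : ℝ)) ^ 2 = normSq t / (δ : ℝ) ^ 2 := by
          rw [div_pow, Real.sq_sqrt (normSq_nonneg t)]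
        rw [← h5]
        nlinarith [sq_nonneg (√(normSq t) / (δ : ℝ) - 1)]
      calc a * (1 - radCF s ν t) ≤ a * (n ^ 2 * (1 - radCF s ν t')) := by
            gcongr
            conv_lhs => rw [htt]
            exact one_sub_radCF_nsmul_le hs ν n t'
        _ = n ^ 2 * (a * (1 - radCF s ν t')) := by ring
        _ ≤ n ^ 2 * ε := by gcongr; exact h t' h2
        _ ≤ _ := by rw [mul_comm]; gcongr
  have hint : Integrable (radCF s ν) (rayleighProd s fun _ : Fin k => δ) := by
    refine Integrable.of_bound (continuous_radCF hs ν).aestronglyMeasurable 1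
      (ae_of_all _ fun t => ?_)
    have := norm_integral_le_of_norm_le_const (μ := ν) (f := lamProd s t)
      (ae_of_all _ fun x => abs_lamProd_le_one hs t x)
    simpa [radCF_eq] using this
  have hexp : Integrable (fun x : Fin k → ℝ≥0 =>
      Real.exp (-(curv s * (δ : ℝ) ^ 2 * normSq x))) ν := by
    have hc := continuous_normSq (k := k)
    refine Integrable.of_bound (Continuous.aestronglyMeasurable (by fun_prop)) 1
      (ae_of_all _ fun x => ?_)
    have := normSq_nonneg x
    have := curv_pos hs
    rw [Real.norm_of_nonneg (Real.exp_pos _).le, Real.exp_le_one_iff, neg_nonpos]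
    positivity
  have h1 : ∫ x, (1 - Real.exp (-(curv s * (δ : ℝ) ^ 2 * normSq x))) ∂ν =
      ∫ t, (1 - radCF s ν t) ∂rayleighProd s fun _ => δ := by
    rw [integral_sub (integrable_const _) hexp, integral_sub (integrable_const _) hint,
      integral_radCF_rayleighProd hs]
    simp only [integral_const, probReal_univ, smul_eq_mul, mul_one]
    congr 1
    refine integral_congr_ae (ae_of_all _ fun x => ?_)
    simp only
    rw [← Finset.mul_sum, normSq, mul_assoc]
  have hnorm := integrable_normSq_rayleighProd hs (fun _ : Fin k => δ)
  -- The Rayleigh mean of `‖t‖²` is `kδ²`, which turns the pointwise bound into the constant `2k +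
  -- 2`.
  have hI : ∫ t, normSq t ∂rayleighProd s (fun _ : Fin k => δ) = k * (δ : ℝ) ^ 2 := by
    unfold normSq
    rw [integral_finsetSum _ fun j _ => (integrable_sq_rayleighProd hs _ j).1]
    simp [(integrable_sq_rayleighProd hs (fun _ : Fin k => δ) _).2]
  rw [h1, ← integral_const_mul]
  calc ∫ t, a * (1 - radCF s ν t) ∂rayleighProd s (fun _ => δ)
      ≤ ∫ t, ε * (2 * (normSq t / (δ : ℝ) ^ 2) + 2) ∂rayleighProd s (fun _ => δ) :=
        integral_mono (((integrable_const _).sub hint).const_mul _)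
          ((((hnorm.div_const _).const_mul _).add (integrable_const _)).const_mul _) hbound
    _ = (2 * k + 2) * ε := by
      rw [integral_const_mul, integral_add ((hnorm.div_const _).const_mul _) (integrable_const _),
        integral_const_mul, integral_div, hI]
      simp only [integral_const, probReal_univ, smul_eq_mul]
      field_simp

/-- A form of Prokhorov's theorem on the cone, along an ultrafilter. -/
theorem exists_tendsto_integral_of_tight {ι : Type*} (F : Ultrafilter ι)
    {V : ι → Measure (Fin k → ℝ≥0)} {C : ℝ≥0} (hC : ∀ i, V i univ ≤ C)
    (ht : ∀ ε : ℝ≥0, 0 < ε → ∃ R : ℝ≥0, ∀ i, V i (Iic fun _ => R)ᶜ ≤ ε) :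
    ∃ V' : Measure (Fin k → ℝ≥0), IsFiniteMeasure V' ∧
      ∀ g : BoundedContinuousFunction (Fin k → ℝ≥0) ℝ,
        Tendsto (fun i => ∫ x, g x ∂V i) F (𝓝 (∫ x, g x ∂V')) := by
  have hfin : ∀ i, IsFiniteMeasure (V i) := fun i => ⟨(hC i).trans_lt ENNReal.coe_lt_top⟩
  choose R hR using fun n : ℕ => ht ((n : ℝ≥0) + 1)⁻¹ (by positivity)
  have hu : Tendsto (fun n : ℕ => ((n : ℝ≥0) + 1)⁻¹) atTop (𝓝 0) :=
    tendsto_inv_natCast_add_one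
  have hK : ∀ n, IsCompact (Iic fun _ : Fin k => R n) := fun n => by
    have : Iic (fun _ : Fin k => R n) = Icc 0 fun _ : Fin k => R n := by
      ext x
      simp
    rw [this]
    exact isCompact_Icc
  have hcomp := isCompact_setOfPred_finiteMeasure_mass_le_compl_isCompact_le C hu hK
    (Or.inl inferInstance)
  let Vf : ι → FiniteMeasure (Fin k → ℝ≥0) := fun i => ⟨V i, hfin i⟩
  obtain ⟨V', -, hV'⟩ := hcomp.ultrafilter_le_nhds (F.map Vf) (by
    rw [le_principal_iff]
    refine Filter.mem_map.2 (Filter.univ_mem' fun i => ?_)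
    refine ⟨?_, fun n => ?_⟩
    · rw [← ENNReal.coe_le_coe, FiniteMeasure.ennreal_mass]
      exact hC i
    · rw [← ENNReal.coe_le_coe, FiniteMeasure.ennreal_coeFn_eq_coeFn_toMeasure]
      exact hR n i)
  refine ⟨V', inferInstance, fun g => ?_⟩
  exact FiniteMeasure.tendsto_iff_forall_integral_tendsto.1 (show Tendsto Vf F (𝓝 V') from hV') g

/-! ### Coordinate weights and weighted root measures -/

/-- The weight `x_j² / (1 + x_j²)`. -/
noncomputable def coordWeight (j : Fin k) (x : Fin k → ℝ≥0) : ℝ := (x j : ℝ) ^ 2 / (1 + (x j : ℝ) ^ 2)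

theorem coordWeight_nonneg (j : Fin k) (x : Fin k → ℝ≥0) : 0 ≤ coordWeight j x := by
  unfold coordWeight
  positivity

theorem coordWeight_le_one (j : Fin k) (x : Fin k → ℝ≥0) : coordWeight j x ≤ 1 := by
  rw [coordWeight, div_le_one (by positivity)]
  linarith

theorem continuous_coordWeight (j : Fin k) : Continuous (coordWeight j) := by
  unfold coordWeight
  exact Continuous.div (by fun_prop) (by fun_prop) fun x => by positivity

theorem div_one_add_le_one_sub_exp_neg {y : ℝ} (hy : 0 ≤ y) :
    y / (1 + y) ≤ 1 - Real.exp (-y) := by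
  have h1 : Real.exp (-y) ≤ 1 / (1 + y) := by
    rw [Real.exp_neg, ← one_div]
    gcongr
    linarith [Real.add_one_le_exp y]
  have h2 : y / (1 + y) = 1 - 1 / (1 + y) := by field_simp; ring
  linarith

theorem coordWeight_le_mul_one_sub_exp {b : ℝ} (hb : 0 < b) (j : Fin k) (x : Fin k → ℝ≥0) :
    coordWeight j x ≤ (1 + 1 / b) * (1 - Real.exp (-(b * normSq x))) := by
  have h0 : (0 : ℝ) ≤ (x j : ℝ) ^ 2 := by positivity
  calc coordWeight j x ≤ (1 + 1 / b) * (b * (x j : ℝ) ^ 2 / (1 + b * (x j : ℝ) ^ 2)) := by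
        have e : (1 + 1 / b) * (b * (x j : ℝ) ^ 2 / (1 + b * (x j : ℝ) ^ 2)) =
            (b + 1) * (x j : ℝ) ^ 2 / (1 + b * (x j : ℝ) ^ 2) := by field_simp
        rw [e, coordWeight, div_le_div_iff₀ (by positivity) (by positivity)]
        nlinarith [mul_nonneg h0 h0]
    _ ≤ (1 + 1 / b) * (1 - Real.exp (-(b * (x j : ℝ) ^ 2))) := by
        gcongr
        exact div_one_add_le_one_sub_exp_neg (by positivity)
    _ ≤ _ := by
        gcongr
        exact sq_le_normSq x j

/-- Far from `0` the constant `2` does not depend on `b`, unlike `1 + 1/b` in the global bound. So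
tails are made small by shrinking `b`, while the global bound is used for one fixed `b`. -/
theorem coordWeight_le_two_mul_one_sub_exp {b R : ℝ} (hR : 1 ≤ b * R ^ 2) (hR0 : 0 ≤ R)
    (hb : 0 < b) (j : Fin k) {x : Fin k → ℝ≥0} (hx : ∃ i, R < x i) :
    coordWeight j x ≤ 2 * (1 - Real.exp (-(b * normSq x))) := by
  obtain ⟨i, hi⟩ := hx
  have h1 : 1 ≤ b * normSq x := hR.trans (by
    have := sq_le_normSq x i
    have : R ^ 2 ≤ (x i : ℝ) ^ 2 := by gcongr
    gcongr
    linarith)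
  have h2 := div_one_add_le_one_sub_exp_neg (zero_le_one.trans h1)
  have h3 : 1 / 2 ≤ b * normSq x / (1 + b * normSq x) := by
    rw [div_le_div_iff₀ (by norm_num) (by linarith)]
    linarith
  linarith [coordWeight_le_one j x]

/-- The measure `a x_j² / (1 + x_j²) ν(dx)`. -/
noncomputable def weighted (a : ℝ) (ν : Measure (Fin k → ℝ≥0)) (j : Fin k) :
    Measure (Fin k → ℝ≥0) :=
  ν.withDensity fun x => ENNReal.ofReal (a * coordWeight j x)

theorem integral_weighted {a : ℝ} (ha : 0 ≤ a) (ν : Measure (Fin k → ℝ≥0)) (j : Fin k)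
    (g : (Fin k → ℝ≥0) → ℝ) :
    ∫ x, g x ∂weighted a ν j = ∫ x, a * (coordWeight j x * g x) ∂ν := by
  have hm := (continuous_coordWeight j).measurable
  rw [weighted, integral_withDensity_eq_integral_toReal_smul (by fun_prop)
    (ae_of_all _ fun _ => ENNReal.ofReal_lt_top)]
  refine integral_congr_ae (ae_of_all _ fun x => ?_)
  simp only [smul_eq_mul]
  rw [ENNReal.toReal_ofReal (mul_nonneg ha (coordWeight_nonneg j x)), mul_assoc]

theorem weighted_le {a c b D : ℝ} (ha : 0 ≤ a) (hc : 0 ≤ c) (hb : 0 ≤ b)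
    {ν : Measure (Fin k → ℝ≥0)} [IsProbabilityMeasure ν] (j : Fin k) {A : Set (Fin k → ℝ≥0)}
    (hA : MeasurableSet A)
    (hw : ∀ x ∈ A, coordWeight j x ≤ c * (1 - Real.exp (-(b * normSq x))))
    (h : a * ∫ x, (1 - Real.exp (-(b * normSq x))) ∂ν ≤ D) :
    weighted a ν j A ≤ ENNReal.ofReal (c * D) := by
  have hcont := continuous_normSq (k := k)
  have h01 : ∀ x : Fin k → ℝ≥0, 0 ≤ 1 - Real.exp (-(b * normSq x)) ∧
      1 - Real.exp (-(b * normSq x)) ≤ 1 := fun x => by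
    have := normSq_nonneg x
    refine ⟨sub_nonneg.2 (Real.exp_le_one_iff.2 (neg_nonpos.2 (by positivity))), ?_⟩
    linarith [Real.exp_pos (-(b * normSq x))]
  have hint : Integrable (fun x : Fin k → ℝ≥0 => 1 - Real.exp (-(b * normSq x))) ν := by
    refine Integrable.of_bound (Continuous.aestronglyMeasurable (by fun_prop)) 1
      (ae_of_all _ fun x => ?_)
    rw [Real.norm_of_nonneg (h01 x).1]
    exact (h01 x).2
  calc weighted a ν j A = ∫⁻ x in A, ENNReal.ofReal (a * coordWeight j x) ∂ν :=
        withDensity_apply _ hA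
    _ ≤ ∫⁻ x in A, ENNReal.ofReal (c * (a * (1 - Real.exp (-(b * normSq x))))) ∂ν := by
        refine setLIntegral_mono' hA fun x hx => ENNReal.ofReal_le_ofReal ?_
        rw [mul_left_comm]
        exact mul_le_mul_of_nonneg_left (hw x hx) ha
    _ ≤ ∫⁻ x, ENNReal.ofReal (c * (a * (1 - Real.exp (-(b * normSq x))))) ∂ν :=
        setLIntegral_le_lintegral _ _
    _ = ENNReal.ofReal (∫ x, c * (a * (1 - Real.exp (-(b * normSq x)))) ∂ν) := by
        refine (ofReal_integral_eq_lintegral_ofReal ((hint.const_mul a).const_mul c)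
          (ae_of_all _ fun x => ?_)).symm
        exact mul_nonneg hc (mul_nonneg ha (h01 x).1)
    _ ≤ ENNReal.ofReal (c * D) := by
        refine ENNReal.ofReal_le_ofReal ?_
        rw [integral_const_mul, integral_const_mul]
        gcongr

/-- The `j`-th term of `1 - ∏ Λ_s(t_i x_i)`, divided by `x_j² / (1 + x_j²)`. -/
noncomputable def levyTermAux (s : ℝ) (t : Fin k → ℝ≥0) (j : Fin k) (x : Fin k → ℝ≥0) : ℝ :=
  (t j : ℝ) ^ 2 * lamQuot s (t j * x j) * (1 + (x j : ℝ) ^ 2) *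
    ∏ i with i < j, bigLam s ((t i : ℝ) * x i)

theorem continuous_levyTermAux (hs : -1 / 2 ≤ s) (t : Fin k → ℝ≥0) (j : Fin k) :
    Continuous (levyTermAux s t j) := by
  have h1 : Continuous fun x : Fin k → ℝ≥0 => lamQuot s (t j * x j) :=
    (continuous_lamQuot hs).comp (by fun_prop)
  have h2 : Continuous fun x : Fin k → ℝ≥0 => ∏ i with i < j, bigLam s ((t i : ℝ) * x i) :=
    continuous_finsetProd _ fun i _ => (continuous_bigLam hs).comp (by fun_prop)
  unfold levyTermAux
  fun_prop

theorem abs_levyTermAux_le (hs : -1 / 2 ≤ s) (t : Fin k → ℝ≥0) (j : Fin k) (x : Fin k → ℝ≥0) :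
    |levyTermAux s t j x| ≤ (t j : ℝ) ^ 2 / 2 + 2 := by
  have h1 : |∏ i with i < j, bigLam s ((t i : ℝ) * x i)| ≤ 1 := by
    rw [Finset.abs_prod]
    exact Finset.prod_le_one (fun _ _ => abs_nonneg _) fun _ _ => abs_bigLam_le_one hs _
  have h2 := lamQuot_nonneg hs (t j * x j)
  have h3 := one_sub_bigLam hs (t j * x j)
  rw [levyTermAux, abs_mul, abs_of_nonneg (by positivity)]
  refine (mul_le_of_le_one_right (by positivity) h1).trans ?_
  have h4 := one_sub_bigLam_le_two hs (t j * x j)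
  have h5 : (t j : ℝ) ^ 2 * lamQuot s (t j * x j) ≤ (t j : ℝ) ^ 2 * (1 / 2) := by
    gcongr
    exact lamQuot_le hs _
  rw [mul_pow] at h3
  linarith

/-- `levyTermAux` as a bounded continuous function. -/
noncomputable def levyTerm (hs : -1 / 2 ≤ s) (t : Fin k → ℝ≥0) (j : Fin k) :
    BoundedContinuousFunction (Fin k → ℝ≥0) ℝ :=
  BoundedContinuousFunction.ofNormedAddCommGroup (levyTermAux s t j)
    (continuous_levyTermAux hs t j) _ (abs_levyTermAux_le hs t j)

theorem levyTerm_apply (hs : -1 / 2 ≤ s) (t : Fin k → ℝ≥0) (j : Fin k) (x : Fin k → ℝ≥0) :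
    levyTerm hs t j x = levyTermAux s t j x := rfl

theorem levyTerm_zero (hs : -1 / 2 ≤ s) (t : Fin k → ℝ≥0) (j : Fin k) :
    levyTerm hs t j 0 = curv s * (t j : ℝ) ^ 2 := by
  rw [levyTerm_apply, levyTermAux]
  simp [lamQuot_zero, bigLam_zero hs]
  ring

theorem sum_coordWeight_mul_levyTerm (hs : -1 / 2 ≤ s) (t x : Fin k → ℝ≥0) :
    ∑ j, coordWeight j x * levyTerm hs t j x = 1 - lamProd s t x := by
  rw [one_sub_lamProd]
  refine Finset.sum_congr rfl fun j _ => ?_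
  rw [levyTerm_apply, levyTermAux, coordWeight, one_sub_bigLam hs, ← mul_assoc]
  congr 1
  field_simp

/-! ### Limits of the weighted roots -/

/-- The limit measures from which the Lévy pair is assembled. -/
theorem exists_limit_measures (hs : -1 / 2 ≤ s) {μ : Measure (Fin k → ℝ≥0)}
    [IsProbabilityMeasure μ] (hμ : IsInfDiv s μ) :
    (∀ t, 0 < radCF s μ t) ∧
    ∃ V : Fin k → Measure (Fin k → ℝ≥0), (∀ j, IsFiniteMeasure (V j)) ∧
      (∀ t, -Real.log (radCF s μ t) = ∑ j, ∫ x, levyTerm hs t j x ∂V j) ∧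
      ∀ i j, ∀ g : BoundedContinuousFunction (Fin k → ℝ≥0) ℝ,
        ∫ x, coordWeight i x * g x ∂V j = ∫ x, coordWeight j x * g x ∂V i := by
  -- For odd orders, positivity of the power gives positivity of the root.
  choose ν hν hpow using fun m : ℕ => hμ (2 * m + 1) (by omega)
  have hroot : ∀ m t, radCF s (ν m) t ^ (2 * m + 1) = radCF s μ t := fun m t => by
    rw [← radCF_convPow hs, ← hpow]
  have hpos : ∀ t, 0 < radCF s μ t := radCF_pos_of_roots hs hroot
  refine ⟨hpos, ?_⟩
  have hc := curv_pos hs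
  have hle1 : ∀ t, radCF s μ t ≤ 1 := fun t => by
    have := norm_integral_le_of_norm_le_const (μ := μ) (f := lamProd s t)
      (ae_of_all _ fun x => abs_lamProd_le_one hs t x)
    rw [radCF_eq]
    refine (le_abs_self _).trans ?_
    simpa using this
  have hψ : ∀ m t, ((2 * m + 1 : ℕ) : ℝ) * (1 - radCF s (ν m) t) ≤ -Real.log (radCF s μ t) :=
    fun m t => (mul_one_sub_le_neg_log ⟨m, rfl⟩ (hroot m t) (hpos t)).2
  have hnear : ∀ ε : ℝ, 0 < ε → ∃ δ : ℝ≥0, 0 < δ ∧ ∀ m,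
      ((2 * m + 1 : ℕ) : ℝ) * ∫ x, (1 - Real.exp (-(curv s * (δ : ℝ) ^ 2 * normSq x))) ∂ν m ≤
        (2 * k + 2) * ε := by
    intro ε hε
    have hcont : ContinuousAt (fun t => -Real.log (radCF s μ t)) 0 :=
      ((continuous_radCF hs μ).continuousAt.log (hpos 0).ne').neg
    have h1 : ∀ᶠ t in 𝓝 (0 : Fin k → ℝ≥0), -Real.log (radCF s μ t) < ε :=
      hcont.eventually (gt_mem_nhds (by simp [radCF_zero hs, hε]))
    obtain ⟨η, hη, hball⟩ := Metric.eventually_nhds_iff.1 h1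
    refine ⟨⟨η / 2, by positivity⟩, NNReal.coe_pos.1 (half_pos hη), fun m => ?_⟩
    refine mul_integral_one_sub_exp_le hs (by positivity) hε.le
      (NNReal.coe_pos.1 (half_pos hη)) fun t ht => (hψ m t).trans ?_
    refine (hball ?_).le
    rw [dist_pi_lt_iff hη]
    intro j
    have h2 := (sq_le_normSq t j).trans ht
    have h3 : (t j : ℝ) ≤ η / 2 := (sq_le_sq₀ (by positivity) (by positivity)).1 h2
    rw [Pi.zero_apply, NNReal.dist_eq, NNReal.coe_zero, sub_zero, abs_of_nonneg (by positivity)]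
    linarith
  let V : ℕ → Fin k → Measure (Fin k → ℝ≥0) := fun m j => weighted ((2 * m + 1 : ℕ) : ℝ) (ν m) j
  obtain ⟨δ₁, hδ₁, hmass⟩ := hnear 1 one_pos
  -- All coordinates use the same ultrafilter, so identities between the `V m j` pass to the limits.
  have hV : ∀ j, ∃ V' : Measure (Fin k → ℝ≥0), IsFiniteMeasure V' ∧
      ∀ g : BoundedContinuousFunction (Fin k → ℝ≥0) ℝ,
        Tendsto (fun m => ∫ x, g x ∂V m j) (Ultrafilter.of atTop : Ultrafilter ℕ)
          (𝓝 (∫ x, g x ∂V')) := by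
    intro j
    refine exists_tendsto_integral_of_tight _
      (C := ((1 + 1 / (curv s * (δ₁ : ℝ) ^ 2)) * ((2 * k + 2) * 1)).toNNReal) (fun m => ?_)
      fun ε hε => ?_
    · exact weighted_le (by positivity) (by positivity) (by positivity) j MeasurableSet.univ
        (fun x _ => coordWeight_le_mul_one_sub_exp (by positivity) j x) (hmass m)
    · have hε' : (0 : ℝ) < ε := hε
      -- The tolerance is chosen so that the factor `2` of the tail bound and `2k + 2` multiply it
      -- to exactly `ε`.
      obtain ⟨δ, hδ, hδm⟩ := hnear ((ε : ℝ) / (2 * (2 * k + 2))) (by positivity)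
      have hb : 0 < curv s * (δ : ℝ) ^ 2 := by positivity
      obtain ⟨R, hR⟩ : ∃ R : ℝ≥0, 1 ≤ curv s * (δ : ℝ) ^ 2 * (R : ℝ) ^ 2 := by
        refine ⟨NNReal.sqrt ((curv s * (δ : ℝ) ^ 2).toNNReal)⁻¹, ?_⟩
        rw [← NNReal.coe_pow (NNReal.sqrt _), NNReal.sq_sqrt, NNReal.coe_inv,
          Real.coe_toNNReal _ hb.le, mul_inv_cancel₀ hb.ne']
      refine ⟨R, fun m => ?_⟩
      have h1 := weighted_le (a := ((2 * m + 1 : ℕ) : ℝ)) (c := 2) (ν := ν m) (by positivity)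
        (by positivity) hb.le j (A := (Iic fun _ => R)ᶜ) measurableSet_Iic.compl (fun x hx => by
          refine coordWeight_le_two_mul_one_sub_exp hR R.coe_nonneg hb j ?_
          by_contra hcon
          push Not at hcon
          exact hx fun i => NNReal.coe_le_coe.1 (hcon i)) (hδm m)
      refine h1.trans (le_of_eq ?_)
      have e : (2 : ℝ) * ((2 * k + 2) * ((ε : ℝ) / (2 * (2 * k + 2)))) = ε := by field_simp
      rw [e, ENNReal.ofReal_coe_nnreal]
  choose V' hfin hlim using hV
  refine ⟨V', hfin, fun t => ?_, fun i j g => ?_⟩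
  · have h1 : Tendsto (fun m => ∑ j, ∫ x, levyTerm hs t j x ∂V m j)
        (Ultrafilter.of atTop : Ultrafilter ℕ) (𝓝 (∑ j, ∫ x, levyTerm hs t j x ∂V' j)) :=
      tendsto_finsetSum _ fun j _ => hlim j _
    have h2 : ∀ m, ∑ j, ∫ x, levyTerm hs t j x ∂V m j =
        ((2 * m + 1 : ℕ) : ℝ) * (1 - radCF s (ν m) t) := fun m => by
      have hint : ∀ j : Fin k, Integrable (fun x => ((2 * m + 1 : ℕ) : ℝ) *
          (coordWeight j x * levyTerm hs t j x)) (ν m) := fun j => by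
        refine (((levyTerm hs t j).integrable (ν m)).bdd_mul (c := 1)
          (continuous_coordWeight j).aestronglyMeasurable (ae_of_all _ fun x => ?_)).const_mul _
        rw [Real.norm_of_nonneg (coordWeight_nonneg j x)]
        exact coordWeight_le_one j x
      simp only [V, integral_weighted (Nat.cast_nonneg (2 * m + 1) : (0 : ℝ) ≤ _)]
      rw [← integral_finsetSum _ fun j _ => hint j, one_sub_radCF hs, ← integral_const_mul]
      refine integral_congr_ae (ae_of_all _ fun x => ?_)
      simp only
      rw [← Finset.mul_sum, sum_coordWeight_mul_levyTerm]
    simp only [h2] at h1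
    exact tendsto_nhds_unique ((tendsto_mul_one_sub_of_pow_eq (hpos t) (hle1 t)
      fun m => hroot m t).mono_left (Ultrafilter.of_le _)) h1
  -- Before the limit both integrals are that of `N w_i w_j g` against the root measure.
  · have hcomm : ∀ (i j : Fin k), Tendsto (fun m => ∫ x, coordWeight i x * g x ∂V m j)
        (Ultrafilter.of atTop : Ultrafilter ℕ) (𝓝 (∫ x, coordWeight i x * g x ∂V' j)) :=
      fun i j => by
        let w : BoundedContinuousFunction (Fin k → ℝ≥0) ℝ :=
          BoundedContinuousFunction.ofNormedAddCommGroup (coordWeight i)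
            (continuous_coordWeight i) 1 fun x => by
              rw [Real.norm_of_nonneg (coordWeight_nonneg i x)]
              exact coordWeight_le_one i x
        exact hlim j (w * g)
    refine tendsto_nhds_unique (hcomm i j) ((hcomm j i).congr fun m => ?_)
    simp only [V, integral_weighted (Nat.cast_nonneg (2 * m + 1) : (0 : ℝ) ≤ _)]
    exact integral_congr_ae (ae_of_all _ fun x => by ring)

/-! ### Assembly of the Lévy measure -/

/-- The sum of the weights `x_j² / (1 + x_j²)`. -/
noncomputable def totalWeight (x : Fin k → ℝ≥0) : ℝ := ∑ j, coordWeight j x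

theorem continuous_totalWeight : Continuous (totalWeight : (Fin k → ℝ≥0) → ℝ) :=
  continuous_finsetSum _ fun j _ => continuous_coordWeight j

theorem normSq_div_le_totalWeight (x : Fin k → ℝ≥0) :
    normSq x / (1 + normSq x) ≤ totalWeight x := by
  unfold totalWeight
  conv_lhs => enter [1]; unfold normSq
  rw [Finset.sum_div]
  refine Finset.sum_le_sum fun j _ => ?_
  have := sq_le_normSq x j
  unfold coordWeight
  gcongr

theorem totalWeight_pos {x : Fin k → ℝ≥0} (hx : x ≠ 0) : 0 < totalWeight x := by
  have := normSq_pos hx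
  exact lt_of_lt_of_le (by positivity) (normSq_div_le_totalWeight x)

theorem totalWeight_nonneg (x : Fin k → ℝ≥0) : 0 ≤ totalWeight x :=
  Finset.sum_nonneg fun j _ => coordWeight_nonneg j x

/-- The density of the Lévy measure with respect to the sum of the limit measures. -/
noncomputable def levyDensity (x : Fin k → ℝ≥0) : ℝ :=
  normSq x / (1 + normSq x) / totalWeight x

theorem levyDensity_nonneg (x : Fin k → ℝ≥0) : 0 ≤ levyDensity x := by
  have := normSq_nonneg x
  have := totalWeight_nonneg x
  unfold levyDensity
  positivity

theorem levyDensity_le_one (x : Fin k → ℝ≥0) : levyDensity x ≤ 1 :=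
  div_le_one_of_le₀ (normSq_div_le_totalWeight x) (totalWeight_nonneg x)

theorem measurable_levyDensity : Measurable (levyDensity : (Fin k → ℝ≥0) → ℝ) := by
  have h1 := (continuous_normSq (k := k)).measurable
  have h2 := (continuous_totalWeight (k := k)).measurable
  unfold levyDensity
  fun_prop

/-- Heuristically `V_j = w_j N` off `0` for a common measure `N`, so `∑ V_j` is `totalWeight` times
`N` and dividing by `totalWeight` recovers `N`; the factor `‖x‖²/(1+‖x‖²)` cancels the one in the
integrand. -/
theorem levyDensity_mul_levyIntegrand {x : Fin k → ℝ≥0} (hx : x ≠ 0) (t : Fin k → ℝ≥0) :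
    levyDensity x * levyIntegrand s t x = (1 - lamProd s t x) / totalWeight x := by
  have h1 := normSq_pos hx
  have h2 := totalWeight_pos hx
  rw [levyDensity, levyIntegrand_eq]
  field_simp

theorem isLevyMeasure_of_isFiniteMeasure {M : Measure (Fin k → ℝ≥0)} [IsFiniteMeasure M]
    (h : M {0} = 0) : IsLevyMeasure M where
  sigmaFinite := inferInstance
  zero := h
  finite_compl U _ := measure_lt_top M _
  lintegral_lt_top := by
    refine (lintegral_mono (g := fun _ => 1) fun x => ?_).trans_lt (by simp)
    have := normSq_nonneg x
    exact ENNReal.ofReal_le_one.2 ((div_le_one (by positivity)).2 (by linarith))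

/-- The gluing condition `w_i V_j = w_j V_i`, upgraded from test functions to measures so that it
can be restricted to the complement of `0` and applied to discontinuous integrands. -/
theorem withDensity_coordWeight_comm {V : Fin k → Measure (Fin k → ℝ≥0)}
    [∀ j, IsFiniteMeasure (V j)]
    (hV : ∀ i j, ∀ g : BoundedContinuousFunction (Fin k → ℝ≥0) ℝ,
      ∫ x, coordWeight i x * g x ∂V j = ∫ x, coordWeight j x * g x ∂V i) (i j : Fin k) :
    (V j).withDensity (fun x => ENNReal.ofReal (coordWeight i x)) =
      (V i).withDensity fun x => ENNReal.ofReal (coordWeight j x) := by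
  have hm := fun j : Fin k => (continuous_coordWeight j).measurable
  have hint : ∀ i j : Fin k, Integrable (coordWeight i) (V j) := fun i j =>
    Integrable.of_bound (hm i).aestronglyMeasurable 1 (ae_of_all _ fun x => by
      rw [Real.norm_of_nonneg (coordWeight_nonneg i x)]
      exact coordWeight_le_one i x)
  have hfin : ∀ i j : Fin k, IsFiniteMeasure
      ((V j).withDensity fun x => ENNReal.ofReal (coordWeight i x)) := fun i j =>
    isFiniteMeasure_withDensity_ofReal (hint i j).2
  have := hfin i j
  have := hfin j i
  have h : ∀ (i j : Fin k) (g : BoundedContinuousFunction (Fin k → ℝ≥0) ℝ),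
      ∫ x, g x ∂(V j).withDensity (fun x => ENNReal.ofReal (coordWeight i x)) =
        ∫ x, coordWeight i x * g x ∂V j := fun i j g => by
    rw [integral_withDensity_eq_integral_toReal_smul (hm i).ennreal_ofReal
      (ae_of_all _ fun _ => ENNReal.ofReal_lt_top)]
    refine integral_congr_ae (ae_of_all _ fun x => ?_)
    simp only [smul_eq_mul]
    rw [ENNReal.toReal_ofReal (coordWeight_nonneg i x)]
  refine ext_of_forall_integral_eq_of_IsFiniteMeasure fun g => ?_
  rw [h, h, hV]

theorem setIntegral_coordWeight_mul_comm {V : Fin k → Measure (Fin k → ℝ≥0)}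
    [∀ j, IsFiniteMeasure (V j)]
    (hV : ∀ i j, ∀ g : BoundedContinuousFunction (Fin k → ℝ≥0) ℝ,
      ∫ x, coordWeight i x * g x ∂V j = ∫ x, coordWeight j x * g x ∂V i) (i j : Fin k)
    (g : (Fin k → ℝ≥0) → ℝ) {A : Set (Fin k → ℝ≥0)} (hA : MeasurableSet A) :
    ∫ x in A, coordWeight i x * g x ∂V j = ∫ x in A, coordWeight j x * g x ∂V i := by
  have hm := fun j : Fin k => (continuous_coordWeight j).measurable
  have h : ∀ i j : Fin k,
      ∫ x in A, g x ∂(V j).withDensity (fun x => ENNReal.ofReal (coordWeight i x)) =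
        ∫ x in A, coordWeight i x * g x ∂V j := fun i j => by
    rw [setIntegral_withDensity_eq_setIntegral_toReal_smul (hm i).ennreal_ofReal
      (ae_of_all _ fun _ => ENNReal.ofReal_lt_top) _ hA]
    refine setIntegral_congr_fun hA fun x _ => ?_
    simp only [smul_eq_mul]
    rw [ENNReal.toReal_ofReal (coordWeight_nonneg i x)]
  rw [← h, ← h, withDensity_coordWeight_comm hV]

/-- The Lévy measure assembled from the limit measures. -/
noncomputable def levyMeasureOf (V : Fin k → Measure (Fin k → ℝ≥0)) : Measure (Fin k → ℝ≥0) :=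
  (∑ j, (V j).restrict {0}ᶜ).withDensity fun x => ENNReal.ofReal (levyDensity x)

theorem isFiniteMeasure_levyMeasureOf (V : Fin k → Measure (Fin k → ℝ≥0))
    [∀ j, IsFiniteMeasure (V j)] : IsFiniteMeasure (levyMeasureOf V) := by
  have h : Integrable levyDensity (∑ j, (V j).restrict {0}ᶜ) :=
    Integrable.of_bound measurable_levyDensity.aestronglyMeasurable 1 (ae_of_all _ fun x => by
      rw [Real.norm_of_nonneg (levyDensity_nonneg x)]
      exact levyDensity_le_one x)
  exact isFiniteMeasure_withDensity_ofReal h.2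

theorem levyMeasureOf_singleton (V : Fin k → Measure (Fin k → ℝ≥0)) :
    levyMeasureOf V {0} = 0 := by
  refine withDensity_absolutelyContinuous _ _ ?_
  rw [Measure.finsetSum_apply]
  exact Finset.sum_eq_zero fun j _ => by
    rw [Measure.restrict_apply (measurableSet_singleton 0)]
    simp

theorem measurable_levyIntegrand (hs : -1 / 2 ≤ s) (t : Fin k → ℝ≥0) :
    Measurable (levyIntegrand s t) := by
  have h : Measurable fun x => (1 - lamProd s t x) * ((1 + normSq x) / normSq x) := by
    have h1 := (continuous_lamProd hs t).measurable
    have h2 := (continuous_normSq (k := k)).measurable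
    fun_prop
  exact h

theorem norm_levyIntegrand_le (hs : -1 / 2 ≤ s) (t x : Fin k → ℝ≥0) :
    ‖levyIntegrand s t x‖ ≤ 2 + normSq t / 2 := by
  rw [Real.norm_of_nonneg (levyIntegrand_nonneg hs t x)]
  exact levyIntegrand_le hs t x

theorem integral_levyMeasureOf (hs : -1 / 2 ≤ s) (V : Fin k → Measure (Fin k → ℝ≥0))
    [∀ j, IsFiniteMeasure (V j)] (t : Fin k → ℝ≥0) :
    ∫ x, levyIntegrand s t x ∂levyMeasureOf V =
      ∑ j, ∫ x in {0}ᶜ, (1 - lamProd s t x) / totalWeight x ∂V j := by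
  have hA : MeasurableSet ({0}ᶜ : Set (Fin k → ℝ≥0)) := (measurableSet_singleton 0).compl
  have e : ∀ x, (ENNReal.ofReal (levyDensity x)).toReal • levyIntegrand s t x =
      levyDensity x * levyIntegrand s t x := fun x => by
    rw [ENNReal.toReal_ofReal (levyDensity_nonneg x), smul_eq_mul]
  rw [levyMeasureOf, integral_withDensity_eq_integral_toReal_smul
    measurable_levyDensity.ennreal_ofReal (ae_of_all _ fun _ => ENNReal.ofReal_lt_top),
    integral_congr_ae (ae_of_all _ e), integral_finsetSum_measure]
  · exact Finset.sum_congr rfl fun j _ => setIntegral_congr_fun hA fun x hx =>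
      levyDensity_mul_levyIntegrand hx t
  · intro j _
    refine Integrable.of_bound
      (measurable_levyDensity.mul (measurable_levyIntegrand hs t)).aestronglyMeasurable
      (2 + normSq t / 2) (ae_of_all _ fun x => ?_)
    rw [norm_mul, Real.norm_of_nonneg (levyDensity_nonneg x)]
    exact (mul_le_of_le_one_left (norm_nonneg _) (levyDensity_le_one x)).trans
      (norm_levyIntegrand_le hs t x)

theorem integrable_coordWeight_mul_levyTerm (hs : -1 / 2 ≤ s) (P : Measure (Fin k → ℝ≥0))
    [IsFiniteMeasure P] (t : Fin k → ℝ≥0) (l i : Fin k) :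
    Integrable (fun x => coordWeight l x * (levyTerm hs t i x / totalWeight x)) P := by
  have hm1 := (continuous_coordWeight l).measurable
  have hm2 := (continuous_totalWeight (k := k)).measurable
  have hm3 := (levyTerm hs t i).continuous.measurable
  refine Integrable.of_bound (hm1.mul (hm3.div hm2)).aestronglyMeasurable
    ((t i : ℝ) ^ 2 / 2 + 2) (ae_of_all _ fun x => ?_)
  have h2 : coordWeight l x / totalWeight x ≤ 1 := div_le_one_of_le₀
    (Finset.single_le_sum (f := fun j => coordWeight j x)
      (fun j _ => coordWeight_nonneg j x) (Finset.mem_univ l)) (totalWeight_nonneg x)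
  have h3 : 0 ≤ coordWeight l x / totalWeight x :=
    div_nonneg (coordWeight_nonneg l x) (totalWeight_nonneg x)
  rw [mul_div_left_comm, norm_mul, Real.norm_of_nonneg h3]
  exact (mul_le_of_le_one_right (norm_nonneg _) h2).trans (abs_levyTermAux_le hs t i x)

/-- Write `1 - ∏ Λ_s = ∑ w_i T_i` and `W = totalWeight`. The gluing condition replaces `w_i (T_i/W)
dV_j` by `w_j (T_i/W) dV_i`, and summing over `j` cancels `W`. -/
theorem sum_setIntegral_one_sub_lamProd (hs : -1 / 2 ≤ s) {V : Fin k → Measure (Fin k → ℝ≥0)}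
    [∀ j, IsFiniteMeasure (V j)]
    (hV : ∀ i j, ∀ g : BoundedContinuousFunction (Fin k → ℝ≥0) ℝ,
      ∫ x, coordWeight i x * g x ∂V j = ∫ x, coordWeight j x * g x ∂V i) (t : Fin k → ℝ≥0) :
    ∑ j, ∫ x in {0}ᶜ, (1 - lamProd s t x) / totalWeight x ∂V j =
      ∑ j, ∫ x in {0}ᶜ, levyTerm hs t j x ∂V j := by
  have hA : MeasurableSet ({0}ᶜ : Set (Fin k → ℝ≥0)) := (measurableSet_singleton 0).compl
  have hsum : ∀ x, (1 - lamProd s t x) / totalWeight x =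
      ∑ i, coordWeight i x * (levyTerm hs t i x / totalWeight x) := fun x => by
    rw [← sum_coordWeight_mul_levyTerm hs, Finset.sum_div]
    exact Finset.sum_congr rfl fun i _ => by rw [mul_div_assoc]
  have h3 : ∀ j, ∫ x in {0}ᶜ, (1 - lamProd s t x) / totalWeight x ∂V j =
      ∑ i, ∫ x in {0}ᶜ, coordWeight j x * (levyTerm hs t i x / totalWeight x) ∂V i := fun j => by
    simp only [hsum]
    rw [integral_finsetSum _ fun i _ => integrable_coordWeight_mul_levyTerm hs _ t i i]
    exact Finset.sum_congr rfl fun i _ => setIntegral_coordWeight_mul_comm hV i j _ hA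
  simp only [h3]
  rw [Finset.sum_comm]
  refine Finset.sum_congr rfl fun i _ => ?_
  rw [← integral_finsetSum _ fun j _ => integrable_coordWeight_mul_levyTerm hs _ t j i]
  refine setIntegral_congr_fun hA fun x hx => ?_
  rw [← Finset.sum_mul, ← totalWeight, mul_div_cancel₀ _ (totalWeight_pos hx).ne']

/-- The Lévy–Khinchin representation: an infinitely divisible law has a Lévy pair. -/
theorem exists_hasLevyPair (hs : -1 / 2 ≤ s) {μ : Measure (Fin k → ℝ≥0)}
    [IsProbabilityMeasure μ] (hμ : IsInfDiv s μ) :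
    ∃ (M : Measure (Fin k → ℝ≥0)) (lam : Fin k → ℝ≥0), HasLevyPair s μ M lam := by
  obtain ⟨hpos, V, hfin, hlog, hV⟩ := exists_limit_measures hs hμ
  have hc := curv_pos hs
  have hMfin := isFiniteMeasure_levyMeasureOf V
  -- `T_j(0) = κ t_j²`, so the atom of `V_j` at `0` contributes `κ V_j{0} t_j²`, which must equal
  -- `λ_j² t_j²/2`.
  refine ⟨levyMeasureOf V, fun j => NNReal.sqrt (2 * (curv s * (V j).real {0}).toNNReal),
    isLevyMeasure_of_isFiniteMeasure (levyMeasureOf_singleton V), fun t =>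
    Integrable.of_bound (measurable_levyIntegrand hs t).aestronglyMeasurable _
      (ae_of_all _ (norm_levyIntegrand_le hs t)), hpos, fun t => ?_⟩
  have h1 : ∀ j, ∫ x, levyTerm hs t j x ∂V j = curv s * (t j : ℝ) ^ 2 * (V j).real {0} +
      ∫ x in {0}ᶜ, levyTerm hs t j x ∂V j := fun j => by
    rw [← integral_add_compl (measurableSet_singleton (0 : Fin k → ℝ≥0))
      ((levyTerm hs t j).integrable (V j)), integral_singleton, levyTerm_zero, smul_eq_mul,
      mul_comm ((V j).real {0})]
  rw [hlog, integral_levyMeasureOf hs, sum_setIntegral_one_sub_lamProd hs hV]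
  simp only [h1]
  rw [Finset.sum_add_distrib, Finset.mul_sum]
  congr 1
  refine Finset.sum_congr rfl fun j _ => ?_
  have h0 : 0 ≤ curv s * (V j).real {0} := mul_nonneg hc.le measureReal_nonneg
  rw [← NNReal.coe_pow (NNReal.sqrt _), NNReal.sq_sqrt, NNReal.coe_mul, Real.coe_toNNReal _ h0,
    NNReal.coe_ofNat]
  ring

end Kingman

/-! ### The main theorem -/

theorem mainTheorem8 (k : ℕ) (hk : 1 ≤ k) (s : ℝ) (hs : -1 / 2 ≤ s) :
    (∀ μ : Measure (Fin k → ℝ≥0), IsProbabilityMeasure μ → Kingman.IsInfDiv s μ →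
      ∃! p : Measure (Fin k → ℝ≥0) × (Fin k → ℝ≥0), Kingman.HasLevyPair s μ p.1 p.2) ∧
    (∀ μ ν : Measure (Fin k → ℝ≥0), IsProbabilityMeasure μ → IsProbabilityMeasure ν →
      ∀ (M : Measure (Fin k → ℝ≥0)) (lam : Fin k → ℝ≥0),
        Kingman.HasLevyPair s μ M lam → Kingman.HasLevyPair s ν M lam → μ = ν) ∧
    (∀ μ : Measure (Fin k → ℝ≥0), IsProbabilityMeasure μ →
      (Kingman.IsRayleighian s μ ↔
        Kingman.IsInfDiv s μ ∧ ∃ lam : Fin k → ℝ≥0, Kingman.HasLevyPair s μ 0 lam)) := by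
  refine ⟨fun μ _ hdiv => ?_, fun μ ν _ _ M lam h h' => Kingman.eq_of_hasLevyPair hs h h',
    fun μ _ => Kingman.isRayleighian_iff hs μ⟩
  obtain ⟨M, lam, h⟩ := Kingman.exists_hasLevyPair hs hdiv
  refine ⟨(M, lam), h, fun p hp => ?_⟩
  obtain ⟨h1, h2⟩ := hp.unique hs h
  exact Prod.ext h1 h2
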